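/- **Definitions.** An arc-presentation with $\alpha$ pages is a link in $\mathbb R^3$ contained in the union of the $z$-axis and $\alpha$ open half-planes (pages) bounded by the axis, which meets the axis in finitely many points and each page in a single simple arc that joins two distinct points of the axis. It is an arc-presentation of a link $L$ if it is ambient isotopic to $L$ (the least possible $\alpha$ is the arc index of $L$). Its *spoked form* is the closed polygonal diagram in the plane obtained by putting the pages, in their cyclic order, at the angles $2\pi k/\alpha$ ($k=0,\dots,\alpha-1$), replacing the arc in page $k$ by the spoke from the centre $0$ to the point at distance $\ell>0$ in direction $2\pi k/\alpha$, traversed out and back, and joining these at the centre in the order in which the arcs follow each other along the link. Let $D$ be a polygonal link diagram and $w>0$. The ribbon of width $w$ along $D$ has at each vertex with fold angle $\theta<\pi$ a fold line of length $w/\cos(\theta/2)$, centred at the vertex and perpendicular to the bisector of the fold angle (there is no fold line if $\theta=\pi$); its boundary is obtained by joining the ends of consecutive fold lines. The folded ribbon link $D_w$ is *allowed* if its fold lines are disjoint in the ribbon (so the ribbon is immersed away from them) and its crossing and folding information is consistent, i.e. the ribbon is the vertical projection of an embedded ribbon in $\mathbb R^3$; its link type is that of the centre line of that embedded ribbon.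 Its folded ribbonlength is $\operatorname{Rib}(D_w)=\operatorname{Len}(D)/w$. **Proposition.** Let $L$ be a link with an arc-presentation with $\alpha$ pages (for example, $\alpha$ the arc index of $L$), and let $$b=\begin{cases}\alpha\cot(\pi/\alpha) & \text{if }\alpha\text{ is even},\\ \alpha\cot(\pi/(2\alpha)) & \text{if }\alpha\text{ is odd.}\end{cases}$$ Then the arc-presentation can be realized as a folded ribbon link in spoked form with ribbonlength at most $b$, up to an arbitrarily small error. Precisely: there are a length $\ell>0$ and over- and under-information for the spoked form $D$ with spokes of length $\ell$ such that the resulting link is ambient isotopic to $L$, the strands through the centre are stacked in the order of the corresponding points on the axis, and $D_w$ is allowed for every width $w>0$ with $\operatorname{Rib}(D_w)>b$. In particular, for every $\varepsilon>0$ there is a width $w$ for which $D_w$ is allowed and $\operatorname{Rib}(D_w)\le b+\varepsilon$. -/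

import Mathlib

/-- Three-space `ℝ³ = ℂ × ℝ`: horizontal plane `ℂ`, vertical axis `{0} × ℝ`.  Only its topology and
its linear structure are used. -/
abbrev Space : Type := ℂ × ℝ

/-- Ambient isotopy of subsets of `ℝ³`. -/
def AmbientIsotopic (L L' : Set Space) : Prop :=
  ∃ F : unitInterval → (Space ≃ₜ Space),
    Continuous (fun p : unitInterval × Space => F p.1 p.2) ∧
      F 0 = Homeomorph.refl Space ∧ F 1 '' L = L'

/-- A link: a finite disjoint union of embedded circles in `ℝ³` that is ambient isotopic to a
polygonal one (a finite union of line segments). -/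
def IsLink (L : Set Space) : Prop :=
  (∃ (c : ℕ) (γ : Fin c × Circle → Space),
      Continuous γ ∧ Function.Injective γ ∧ Set.range γ = L) ∧
    ∃ (L' : Set Space) (S : Finset (Space × Space)),
      AmbientIsotopic L L' ∧ L' = ⋃ p ∈ S, segment ℝ p.1 p.2

/-- A link in `ℝ³` lying in `n` half-planes ("pages") bounded by the vertical axis, every page
meeting it in a single simple arc.  The link is given an orientation, and each arc is parametrized
along it.

* Page number `k` is the open half-plane at angle `angle k`; the pages are listed in their order
  around the axis.
* `arc k` is the arc in the closure of page `k`, in the coordinates (distance from the axis, height).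
  Its two endpoints, and no other points of it, are on the axis.
* The arc that follows `arc k` along the link is `arc (next k)`.  Since the arcs start at pairwise
  different points of the axis, each point of the link on the axis is the initial point of exactly
  one arc and the final point of exactly one arc, so the union of the arcs is a disjoint union of
  simple closed curves. -/
structure ArcPresentation (n : ℕ) where
  angle : Fin n → ℝ
  angle_nonneg : ∀ k, 0 ≤ angle k
  angle_lt : ∀ k, angle k < 2 * Real.pi
  angle_strictMono : StrictMono angle
  arc : Fin n → unitInterval → ℝ × ℝ
  arc_continuous : ∀ k, Continuous (arc k)
  arc_injective : ∀ k, Function.Injective (arc k)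
  arc_zero : ∀ k, (arc k 0).1 = 0
  arc_one : ∀ k, (arc k 1).1 = 0
  arc_pos : ∀ k t, 0 < t → t < 1 → 0 < (arc k t).1
  next : Equiv.Perm (Fin n)
  arc_next : ∀ k, arc (next k) 0 = arc k 1
  start_injective : Function.Injective (fun k => arc k 0)

namespace ArcPresentation

variable {n : ℕ}

/-- The point set in `ℝ³` of an arc-presentation. -/
def carrier (A : ArcPresentation n) : Set Space :=
  ⋃ k : Fin n, Set.range fun t : unitInterval =>
    ((((A.arc k t).1 : ℂ) * Complex.exp ((A.angle k : ℂ) * Complex.I), (A.arc k t).2) : Space)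

/-- `A` is an arc-presentation of the link `L`. -/
def Presents (A : ArcPresentation n) (L : Set Space) : Prop :=
  AmbientIsotopic A.carrier L

end ArcPresentation

/-- An oriented polygonal link diagram in the plane `ℂ`, not assumed to be regular.  `V` is the set
of all vertices of all components; the edges are the segments from `pos x` to `pos (next x)`, and the
components are the cycles of `next`. -/
structure LinkDiagram (V : Type) where
  next : Equiv.Perm V
  pos : V → ℂ
  pos_next_ne : ∀ x, pos (next x) ≠ pos x

namespace LinkDiagram

variable {V : Type}

/-- The unit direction of the edge that starts at the vertex `x`. -/
noncomputable def dir (D : LinkDiagram V) (x : V) : ℂ :=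
  (D.pos (D.next x) - D.pos x) / (‖D.pos (D.next x) - D.pos x‖ : ℂ)

/-- The total length of the diagram. -/
noncomputable def length [Fintype V] (D : LinkDiagram V) : ℝ :=
  ∑ x, ‖D.pos (D.next x) - D.pos x‖

/-- The folded ribbonlength of the diagram with a ribbon of width `w`. -/
noncomputable def ribbonlength [Fintype V] (D : LinkDiagram V) (w : ℝ) : ℝ :=
  D.length / w

end LinkDiagram

/-- The data of a ribbon folded along a link diagram `D`, apart from its width: the directions of the
fold lines and the over- and under-information.

* `fold x` is a vector along the fold line at the vertex `x`, scaled so that the fold line in the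
  ribbon of width `w` consists of the points `pos x + s * fold x` with `|s| ≤ w / 2`.
* `height x` is the height at which the piece of the ribbon along the edge from `x` to `next x` lies
  over the points of the plane. -/
structure Layering {V : Type} (D : LinkDiagram V) where
  fold : V → ℂ
  height : V → ℂ → ℝ

namespace Layering

variable {V : Type} {D : LinkDiagram V}

/-- The fold line at the vertex `x` of the ribbon of width `w`. -/
def foldLine (R : Layering D) (w : ℝ) (x : V) : Set ℂ :=
  {z | ∃ s : ℝ, |s| ≤ w / 2 ∧ z = D.pos x + (s : ℂ) * R.fold x}

/-- The flat piece of the ribbon of width `w` along the edge from `x` to `next x`: the region bounded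
by the fold lines at its two ends and by the two segments that join their endpoints. -/
def piece (R : Layering D) (w : ℝ) (x : V) : Set ℂ :=
  convexHull ℝ (R.foldLine w x ∪ R.foldLine w (D.next x))

/-- The folded ribbon of width `w` is allowed.

At a vertex `x`, the edges leave in the directions `- dir (prev x)` and `dir x`; their angle `θ` is
the fold angle, and its bisector has the direction `dir x - dir (prev x)`.  So for `θ < π` the first
two conditions say that the fold line is centred at the vertex, is perpendicular to the bisector,
and reaches exactly across the ribbon, so that it has length `w / cos (θ / 2)`.  If `θ = π`, there is
no fold at `x`, and `foldLine w x` is merely some segment through the vertex across the ribbon along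
which two coplanar pieces are joined. -/
structure IsAllowed (R : Layering D) (w : ℝ) : Prop where
  width_pos : 0 < w
  fold_perp : ∀ x, inner ℝ (R.fold x) (D.dir x - D.dir (D.next.symm x)) = 0
  fold_width : ∀ x, |inner ℝ (R.fold x) (Complex.I * D.dir x)| = 1
  /-- The fold lines are disjoint in the ribbon, so the ribbon is immersed away from them. -/
  fold_disjoint : ∀ x, Disjoint (R.foldLine w x) (R.foldLine w (D.next x))
  /-- Consistent crossing and folding information: lifted by the heights, the ribbon is an embedded
  surface in space that projects to the flat folded ribbon, i.e. the heights are continuous, they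
  agree where consecutive pieces are joined, and there are no other coincidences. -/
  height_continuous : ∀ x, ContinuousOn (R.height x) (R.piece w x)
  height_join : ∀ x, ∀ z ∈ R.foldLine w (D.next x), R.height x z = R.height (D.next x) z
  height_ne : ∀ x y, x ≠ y → ∀ z ∈ R.piece w x ∩ R.piece w y, R.height x z = R.height y z →
    (y = D.next x ∧ z ∈ R.foldLine w y) ∨ (x = D.next y ∧ z ∈ R.foldLine w x)

/-- The centre line of the lifted ribbon: the link in space that has `D` as its diagram, with the
crossing information of the ribbon. -/
def core (R : Layering D) : Set Space :=
  ⋃ x : V, (fun z : ℂ => ((z, R.height x z) : Space)) '' segment ℝ (D.pos x) (D.pos (D.next x))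

end Layering

namespace ArcPresentation

variable {n : ℕ}

/-- The spoked form of an arc-presentation with `n` pages: the pages are put at equal angles
`2πk/n` and viewed along the axis.  The vertex `Sum.inl k` is the initial point of arc `k` on the
axis, seen at the centre `0`; the vertex `Sum.inr k` is the end of the `k`-th spoke, at distance `ℓ`
from the centre.  The link runs out along the `k`-th spoke and back to the centre, and then goes on
with the next arc. -/
noncomputable def spoked (A : ArcPresentation n) (ℓ : ℝ) (hℓ : 0 < ℓ) :
    LinkDiagram (Fin n ⊕ Fin n) where
  next :=
    { toFun := Sum.elim (fun k => Sum.inr k) (fun k => Sum.inl (A.next k))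
      invFun := Sum.elim (fun k => Sum.inr (A.next.symm k)) (fun k => Sum.inl k)
      left_inv := by rintro (k | k) <;> simp
      right_inv := by rintro (k | k) <;> simp }
  pos := Sum.elim (fun _ => 0)
    (fun k => (ℓ : ℂ) * Complex.exp (((2 * Real.pi * (k : ℕ) / n : ℝ) : ℂ) * Complex.I))
  pos_next_ne := by
    have h : (ℓ : ℂ) ≠ 0 := by exact_mod_cast hℓ.ne'
    rintro (k | k)
    · simp [h, Complex.exp_ne_zero]
    · intro hk
      have : (ℓ : ℂ) * Complex.exp (((2 * Real.pi * (k : ℕ) / n : ℝ) : ℂ) * Complex.I) = 0 := hk.symm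
      exact mul_ne_zero h (Complex.exp_ne_zero _) this

/-- The bound `α cot(π/α)` for even `α`, and `α cot(π/(2α))` for odd `α`. -/
noncomputable def spokedBound (α : ℕ) : ℝ :=
  if Even α then α * Real.cot (Real.pi / α) else α * Real.cot (Real.pi / (2 * α))

end ArcPresentation

/-! Geometry. Take spokes of length one and put `H = w / 2`. The tip folds lie on the lines `⟨p,
e_m⟩ = 1`, where `e_m` are the spoke directions; these bound the region `⟨p, e_m⟩ < 1` for all `m`,
a regular polygon when there are at least three spokes. Ribbonlength above the bound means `H < tan
(π/α)` for even `α` and `H < tan (π/(2α))` for odd `α` (for `α = 2` it is no restriction). The first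
inequality keeps each tip fold strictly within its side. A fold at the centre, joining spokes `d`
steps apart, has half-length `H / |cos (π d / α)|` and must stay inside the polygon. For odd `α` the
nearly opposite spokes give the worst case and the stronger inequality; for even `α` exactly
opposite spokes need no fold, and `H < tan (π/α)` suffices. This is `IsNarrow` with
`mul_abs_sin_sub_tan_mul_cos_lt` and `cos_add_mul_sin_lt`.

Heights. Over the centre each strand gets the level of its point on the axis. The two pieces meeting
at a central fold are tilted in opposite ways, by less than `η`, so that they agree only on the
fold. Everything is multiplied by `sideProd`, which vanishes exactly on the lines of the sides:
there all heights are zero, but pieces reach these lines only in their tip folds, and those of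
different spokes are disjoint. Elsewhere levels at least `2η` apart stay separated. Hence
`spokedLayering_isAllowed`.

Link type. The centre line of the lifted ribbon is again an arc-presentation, with the same levels
and the same succession of arcs. Such data determine the isotopy class (`ambientIsotopic_carrier`):
pages can be turned to new angles, and an arc can be replaced by any other with the same ends. For
the latter each arc is fanned out of its page by a rotation depending on its parameter, so that all
points get distinct directions; then heights and radii can be changed independently by a shear and a
radial shrinking, and the fan is closed again. -/

open Topology Filter

/-! ### Ambient isotopy as an equivalence relation, and families of bijections. -/

namespace AmbientIsotopic

theorem refl (L : Set Space) : AmbientIsotopic L L :=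
  ⟨fun _ => Homeomorph.refl Space, continuous_snd, rfl, by simp⟩

theorem symm {L L' : Set Space} (h : AmbientIsotopic L L') : AmbientIsotopic L' L := by
  obtain ⟨F, hF, h0, rfl⟩ := h
  refine ⟨fun t => (F 1).symm.trans (F (unitInterval.symm t)), ?_, ?_, ?_⟩
  · have : Continuous fun p : unitInterval × Space => (unitInterval.symm p.1, (F 1).symm p.2) :=
      (unitInterval.continuous_symm.comp continuous_fst).prodMk
        ((F 1).symm.continuous.comp continuous_snd)
    exact hF.comp this
  · ext x <;> simp
  · simp [h0, Set.image_image]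

theorem trans {L L' L'' : Set Space} (h : AmbientIsotopic L L') (h' : AmbientIsotopic L' L'') :
    AmbientIsotopic L L'' := by
  obtain ⟨F, hF, h0, rfl⟩ := h
  obtain ⟨G, hG, g0, rfl⟩ := h'
  refine ⟨fun t => (F t).trans (G t), ?_, ?_, ?_⟩
  · exact hG.comp (continuous_fst.prodMk hF)
  · simp only [h0, g0]; rfl
  · rw [Set.image_image]; rfl

/-- A jointly continuous family of bijections of space, each moving the norm of points down by a
bounded amount only, is an ambient isotopy. -/
theorem of_family (F : unitInterval → Space → Space)
    (hF : Continuous fun p : unitInterval × Space => F p.1 p.2)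
    (hb : ∀ t, Function.Bijective (F t)) (C : ℝ) (hC : ∀ t x, ‖x‖ ≤ ‖F t x‖ + C)
    (h0 : ∀ x, F 0 x = x) (L : Set Space) : AmbientIsotopic L (F 1 '' L) := by
  have hc : ∀ t, Continuous (F t) := fun t => hF.comp (Continuous.prodMk_right t)
  -- The norm bound makes each map proper, hence closed, so a continuous bijection is a
  -- homeomorphism.
  have hp : ∀ t, IsClosedMap (F t) := fun t => by
    refine (isProperMap_iff_tendsto_cocompact.2 ⟨hc t, ?_⟩).isClosedMap
    rw [← Metric.cobounded_eq_cocompact (α := Space), ← tendsto_norm_atTop_iff_cobounded]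
    have h1 : Tendsto (fun x : Space => ‖x‖ - C) (Bornology.cobounded Space) atTop :=
      tendsto_atTop_add_const_right _ _ tendsto_norm_cobounded_atTop
    exact tendsto_atTop_mono (fun x => by linarith [hC t x]) h1
  refine ⟨fun t => (Equiv.ofBijective (F t) (hb t)).toHomeomorphOfContinuousClosed (hc t) (hp t),
    hF, ?_, rfl⟩
  ext x <;> exact congrArg _ (h0 x)

end AmbientIsotopic

/-- A continuous real function on a compact space that factors through a continuous map to a normal
Hausdorff space extends along that map. -/
theorem exists_continuous_extension_of_factorsThrough {X Y : Type} [TopologicalSpace X]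
    [CompactSpace X] [TopologicalSpace Y] [T2Space Y] [NormalSpace Y] {φ : X → Y}
    (hφ : Continuous φ) {f : X → ℝ} (hf : Continuous f) (h : ∀ x x', φ x = φ x' → f x = f x') :
    ∃ g : C(Y, ℝ), ∀ x, g (φ x) = f x := by
  have hc : IsClosed (Set.range φ) := (isCompact_range hφ).isClosed
  let ψ : C(X, Set.range φ) := ⟨Set.rangeFactorization φ, by fun_prop⟩
  have hq : IsQuotientMap ψ :=
    (ψ.continuous.isClosedMap).isQuotientMap ψ.continuous Set.rangeFactorization_surjective
  have hfac : Function.FactorsThrough (⟨f, hf⟩ : C(X, ℝ)) ψ := fun x x' hx =>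
    h x x' (congrArg Subtype.val hx)
  obtain ⟨g, hg⟩ := (hq.lift ⟨f, hf⟩ hfac).exists_restrict_eq hc
  refine ⟨g, fun x => ?_⟩
  have h1 := congrArg (fun k : C(X, ℝ) => k x) (hq.lift_comp ⟨f, hf⟩ hfac)
  have h2 := congrArg (fun k : C(Set.range φ, ℝ) => k (ψ x)) hg
  exact h2.trans h1

/-! ### Elementary isotopies: rotation about the axis, shear along it, radial shrinking towards it.
-/

/-- The subset of space with points `r * e` at height `z`, for `(r, z) = f k x` and `e = e k x`. -/
def sweep {ι X : Type} (e : ι → X → ℂ) (f : ι → X → ℝ × ℝ) : Set Space :=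
  Set.range fun q : ι × X => ((((f q.1 q.2).1 : ℂ) * e q.1 q.2, (f q.1 q.2).2) : Space)

theorem norm_mul_exp_I_mul_ofReal (p : ℂ) (x : ℝ) : ‖p * Complex.exp (Complex.I * x)‖ = ‖p‖ := by
  rw [norm_mul, mul_comm Complex.I, Complex.norm_exp_ofReal_mul_I, mul_one]

theorem norm_exp_I_mul_sub_exp_I_mul_le (x y : ℝ) :
    ‖Complex.exp (Complex.I * x) - Complex.exp (Complex.I * y)‖ ≤ |x - y| := by
  have h : Complex.exp (Complex.I * x) - Complex.exp (Complex.I * y) =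
      (Complex.exp (Complex.I * ((x - y : ℝ) : ℂ)) - 1) * Complex.exp (Complex.I * y) := by
    rw [sub_mul, one_mul, ← Complex.exp_add]; push_cast; ring_nf
  rw [h, norm_mul_exp_I_mul_ofReal]
  exact Real.norm_exp_I_mul_ofReal_sub_one_le

/-- Rotations about the axis by an angle that is a contraction as a function of the direction. -/
theorem bijective_rotate_of_lipschitz (Q : ℂ → ℝ)
    (hQ : ∀ u v, |Q u - Q v| ≤ ‖u - v‖ / 2) :
    Function.Bijective fun u : Metric.sphere (0 : ℂ) 1 =>
      (⟨u * Complex.exp (Complex.I * Q u), by simp⟩ : Metric.sphere (0 : ℂ) 1) := by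
  constructor
  · rintro ⟨u, hu⟩ ⟨v, hv⟩ h
    simp only [Subtype.mk.injEq] at h ⊢
    have hu1 : ‖u‖ = 1 := by simpa using hu
    by_contra hne
    -- Equal images give `‖u - v‖ = ‖exp (i Q v) - exp (i Q u)‖ ≤ |Q v - Q u| ≤ ‖u - v‖ / 2`.
    have h1 : (u - v) * Complex.exp (Complex.I * Q u) =
        v * (Complex.exp (Complex.I * Q v) - Complex.exp (Complex.I * Q u)) := by
      rw [sub_mul, h]; ring
    have h2 := congrArg norm h1
    rw [norm_mul_exp_I_mul_ofReal, norm_mul, show ‖v‖ = 1 by simpa using hv, one_mul] at h2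
    have h3 := norm_exp_I_mul_sub_exp_I_mul_le (Q v) (Q u)
    have h4 := hQ v u
    rw [norm_sub_rev v u] at h4
    have h5 : 0 < ‖u - v‖ := norm_pos_iff.2 (sub_ne_zero.2 hne)
    linarith
  · rintro ⟨u, hu⟩
    have hu1 : ‖u‖ = 1 := by simpa using hu
    -- A preimage of `u` is a fixed point of `v ↦ u exp (-i Q v)`, a contraction of the whole plane;
    -- its values have norm one, so the fixed point is on the circle.
    have hT : ContractingWith (1 / 2)
        (fun v : ℂ => u * Complex.exp (Complex.I * ((-Q v : ℝ) : ℂ))) := by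
      refine ⟨by norm_num [← NNReal.coe_lt_coe], LipschitzWith.of_dist_le_mul fun v w => ?_⟩
      rw [dist_eq_norm, ← mul_sub, norm_mul, hu1, one_mul, dist_eq_norm]
      have h1 := norm_exp_I_mul_sub_exp_I_mul_le (-Q v) (-Q w)
      have h2 := hQ w v
      rw [norm_sub_rev w v] at h2
      rw [show -Q v - -Q w = Q w - Q v by ring] at h1
      push_cast
      push_cast at h1
      linarith
    have hv := hT.fixedPoint_isFixedPt
    set v := ContractingWith.fixedPoint _ hT with hvdef
    have hv' : u * Complex.exp (Complex.I * ((-Q v : ℝ) : ℂ)) = v := hv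
    refine ⟨⟨v, ?_⟩, ?_⟩
    · rw [mem_sphere_zero_iff_norm, ← hv', norm_mul_exp_I_mul_ofReal, hu1]
    · simp only [Subtype.mk.injEq]
      have : u * Complex.exp (Complex.I * ((-Q v : ℝ) : ℂ)) * Complex.exp (Complex.I * Q v) = u := by
        rw [mul_assoc, ← Complex.exp_add]; simp
      rw [hv'] at this
      exact this

theorem Complex.norm_div_norm_self {p : ℂ} (hp : p ≠ 0) : ‖p / ‖p‖‖ = 1 := by
  rw [norm_div, Complex.norm_real, norm_norm, div_self (norm_ne_zero_iff.2 hp)]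

/-- The isotopy of rotations about the axis by an angle that depends continuously on the point and
is a contraction as a function of the direction. -/
theorem ambientIsotopic_rotate (Q : ℝ × ℝ → ℂ → ℝ) (hc : Continuous fun x : (ℝ × ℝ) × ℂ => Q x.1 x.2)
    (hQ : ∀ x u v, |Q x u - Q x v| ≤ ‖u - v‖ / 2) (L : Set Space) :
    AmbientIsotopic L ((fun y : Space =>
      ((y.1 * Complex.exp (Complex.I * Q (‖y.1‖, y.2) (y.1 / ‖y.1‖)), y.2) : Space)) '' L) := by
  have key := AmbientIsotopic.of_family (fun t y =>
      ((y.1 * Complex.exp (Complex.I * ((t * Q (‖y.1‖, y.2) (y.1 / ‖y.1‖) : ℝ) : ℂ)), y.2) : Space))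
      ?_ ?_ 0 ?_ ?_ L
  · simpa using key
  · refine Continuous.prodMk ?_ (by fun_prop)
    rw [continuous_iff_continuousAt]
    rintro ⟨t, p, z⟩
    -- The direction `p / ‖p‖` is discontinuous on the axis, but the map preserves the norm of the
    -- horizontal part, which forces continuity there.
    by_cases hp : p = 0
    · subst hp
      have h0 : Tendsto (fun y : unitInterval × Space => ‖y.2.1‖) (𝓝 (t, (0, z))) (𝓝 0) := by
        have : Continuous (fun y : unitInterval × Space => ‖y.2.1‖) := by fun_prop
        simpa using this.tendsto (t, (0, z))
      simp only [ContinuousAt, zero_mul]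
      refine squeeze_zero_norm (fun y => ?_) h0
      rw [norm_mul_exp_I_mul_ofReal]
    · have h1 : ContinuousAt (fun y : unitInterval × Space => y.2.1 / (‖y.2.1‖ : ℂ)) (t, (p, z)) :=
        ContinuousAt.div (by fun_prop) (by fun_prop) (by simpa using hp)
      have h2 : ContinuousAt (fun y : unitInterval × Space =>
          Q (‖y.2.1‖, y.2.2) (y.2.1 / (‖y.2.1‖ : ℂ))) (t, (p, z)) :=
        ContinuousAt.comp (g := fun x : (ℝ × ℝ) × ℂ => Q x.1 x.2)
          (f := fun y : unitInterval × Space => ((‖y.2.1‖, y.2.2), y.2.1 / (‖y.2.1‖ : ℂ)))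
          hc.continuousAt (ContinuousAt.prodMk (by fun_prop) h1)
      fun_prop
  · intro t
    have hb := fun x : ℝ × ℝ => bijective_rotate_of_lipschitz (fun u => t * Q x u) (fun u v => by
      rw [← mul_sub, abs_mul, abs_of_nonneg t.2.1]
      exact (mul_le_of_le_one_left (abs_nonneg _) t.2.2).trans (hQ x u v))
    constructor
    · rintro ⟨p, z⟩ ⟨q, z'⟩ h
      simp only [Prod.mk.injEq] at h
      obtain ⟨h, rfl⟩ := h
      have hn : ‖p‖ = ‖q‖ := by
        simpa [norm_mul_exp_I_mul_ofReal, -Complex.ofReal_mul] using congrArg norm h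
      by_cases hp : p = 0
      · subst hp
        have : q = 0 := by simpa using hn.symm
        rw [this]
      · have hq : q ≠ 0 := by
          rw [← norm_ne_zero_iff, ← hn]; exact norm_ne_zero_iff.2 hp
        have h2 := @(hb (‖p‖, z)).1 ⟨p / ‖p‖, by simpa using Complex.norm_div_norm_self hp⟩
          ⟨q / ‖q‖, by simpa using Complex.norm_div_norm_self hq⟩ (by
            simp only [Subtype.mk.injEq]
            rw [← hn] at h
            rw [div_mul_eq_mul_div, h, ← hn, div_mul_eq_mul_div])
        simp only [Subtype.mk.injEq] at h2
        rw [← hn] at h2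
        have h3 : (‖p‖ : ℂ) ≠ 0 := by simpa using hp
        rw [div_left_inj' h3] at h2
        rw [h2]
    · rintro ⟨q, z⟩
      by_cases hq : q = 0
      · exact ⟨(0, z), by simp [hq]⟩
      · obtain ⟨⟨u, hu⟩, h⟩ := (hb (‖q‖, z)).2
          ⟨q / ‖q‖, by simpa using Complex.norm_div_norm_self hq⟩
        simp only [Subtype.mk.injEq] at h
        have hu1 : ‖u‖ = 1 := by simpa using hu
        have h3 : (‖q‖ : ℂ) ≠ 0 := by simpa using hq
        have hn : ‖(‖q‖ : ℂ) * u‖ = ‖q‖ := by simp [hu1]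
        refine ⟨(‖q‖ * u, z), ?_⟩
        simp only [hn, Prod.mk.injEq, and_true]
        rw [mul_div_cancel_left₀ _ h3, mul_assoc, h, mul_div_cancel₀ _ h3]
  · rintro t ⟨p, z⟩
    simp only [add_zero, Prod.norm_def, norm_mul_exp_I_mul_ofReal, le_refl]
  · rintro ⟨p, z⟩
    simp

theorem exists_pos_forall_ne_le {ι : Type} [Finite ι] (d : ι → ι → ℝ)
    (hd : ∀ j k, j ≠ k → 0 < d j k) : ∃ δ > 0, ∀ j k, j ≠ k → δ ≤ d j k := by
  have h : ∀ᶠ δ in 𝓝[>] (0 : ℝ), ∀ j k, j ≠ k → δ ≤ d j k := by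
    simp only [eventually_all]
    exact fun j k h => mem_nhdsWithin_of_mem_nhds (Iic_mem_nhds (hd j k h))
  obtain ⟨δ, h1, h2⟩ := (h.and self_mem_nhdsWithin).exists
  exact ⟨δ, h2, h1⟩

/-- Points of finitely many pages can be rotated about the axis by small angles that depend
continuously on the point of the page. -/
theorem exists_ambientIsotopic_sweep_rotate {n : ℕ} {e : Fin n → ℂ} (he : ∀ k, ‖e k‖ = 1)
    (hinj : Function.Injective e) :
    ∃ ε > 0, ∀ c : Fin n → C(ℝ × ℝ, ℝ), (∀ k x, |c k x| ≤ ε) →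
      ∀ (X : Type) (f : Fin n → X → ℝ × ℝ), (∀ k x, 0 ≤ (f k x).1) →
        AmbientIsotopic (sweep (fun k _ => e k) f)
          (sweep (fun k x => e k * Complex.exp (Complex.I * c k (f k x))) f) := by
  obtain ⟨δ, hδ, hδe⟩ := exists_pos_forall_ne_le (fun j k => ‖e j - e k‖)
    (fun j k h => norm_pos_iff.2 (sub_ne_zero.2 (hinj.ne h)))
  obtain ⟨K, hK, hKe⟩ : ∃ K : ℝ, 0 < K ∧ ∀ j k, j ≠ k → 1 ≤ K * ‖e j - e k‖ :=
    ⟨1 / δ, by positivity, fun j k h => by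
      rw [div_mul_eq_mul_div, one_mul, one_le_div hδ]; exact hδe j k h⟩
  -- The angles are spread out by tent functions `b k` of slope `K`, equal to one at `e k` and zero
  -- at the other directions. With this bound the sum of the `n` terms has Lipschitz constant at
  -- most `n / (n + 1) · 1/2`, as `ambientIsotopic_rotate` requires.
  refine ⟨1 / (2 * K * (n + 1)), by positivity, fun c hcε X f hf => ?_⟩
  set b : Fin n → ℂ → ℝ := fun k u => max 0 (1 - K * ‖u - e k‖) with hb
  have hb1 : ∀ k, b k (e k) = 1 := fun k => by simp [hb]
  have hb0 : ∀ j k, j ≠ k → b k (e j) = 0 := fun j k h => by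
    have := hKe j k h
    simp only [hb]
    exact max_eq_left (by linarith)
  have hbl : ∀ k u v, |b k u - b k v| ≤ K * ‖u - v‖ := fun k u v => by
    have h1 := abs_max_sub_max_le_abs (1 - K * ‖u - e k‖) (1 - K * ‖v - e k‖) 0
    simp only [hb, max_comm (0 : ℝ)]
    refine h1.trans ?_
    rw [show 1 - K * ‖u - e k‖ - (1 - K * ‖v - e k‖) = K * (‖v - e k‖ - ‖u - e k‖) by ring, abs_mul,
      abs_of_pos hK]
    have h2 := abs_norm_sub_norm_le (v - e k) (u - e k)
    rw [sub_sub_sub_cancel_right, norm_sub_rev v u] at h2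
    exact mul_le_mul_of_nonneg_left h2 hK.le
  have hQ := ambientIsotopic_rotate (fun x u => ∑ k, c k x * b k u) (by fun_prop) (fun x u v => by
    rw [← Finset.sum_sub_distrib]
    refine (Finset.abs_sum_le_sum_abs _ _).trans ?_
    have h1 : ∀ k ∈ Finset.univ, |c k x * b k u - c k x * b k v| ≤
        1 / (2 * K * (n + 1)) * (K * ‖u - v‖) := fun k _ => by
      rw [← mul_sub, abs_mul]
      exact mul_le_mul (hcε k x) (hbl k u v) (abs_nonneg _) (by positivity)
    refine (Finset.sum_le_sum h1).trans ?_
    rw [Finset.sum_const, Finset.card_univ, Fintype.card_fin, nsmul_eq_mul]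
    have h2 : (n : ℝ) * (1 / (2 * K * (n + 1)) * (K * ‖u - v‖)) =
        (n / (n + 1)) * (‖u - v‖ / 2) := by field_simp
    rw [h2]
    exact mul_le_of_le_one_left (by positivity) (by rw [div_le_one (by positivity)]; linarith))
      (sweep (fun k _ => e k) f)
  convert hQ using 1
  rw [sweep, sweep, ← Set.range_comp]
  congr 1
  funext ⟨k, x⟩
  simp only [Function.comp_apply, Prod.mk.injEq, and_true]
  have hn : ‖((f k x).1 : ℂ) * e k‖ = (f k x).1 := by
    rw [norm_mul, he, mul_one, Complex.norm_real, Real.norm_of_nonneg (hf k x)]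
  rw [hn]
  rcases (hf k x).eq_or_lt with h | h
  · rw [← h]; simp
  · have h3 : ((f k x).1 : ℂ) ≠ 0 := by exact_mod_cast h.ne'
    rw [mul_div_cancel_left₀ _ h3, Finset.sum_eq_single k, hb1, mul_one, mul_assoc]
    · intro j _ hj
      rw [hb0 k j hj.symm, mul_zero]
    · simp

/-- Space is sheared along the axis. -/
theorem ambientIsotopic_shear (β : C(ℂ, ℝ)) (L : Set Space) :
    AmbientIsotopic L ((fun y : Space => ((y.1, y.2 + β y.1) : Space)) '' L) := by
  refine ⟨fun t => ⟨⟨fun y => (y.1, y.2 + t * β y.1), fun y => (y.1, y.2 - t * β y.1), fun y => ?_,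
    fun y => ?_⟩, by fun_prop, by fun_prop⟩, ?_, ?_, ?_⟩
  · simp
  · simp
  · change Continuous fun p : unitInterval × Space => ((p.2.1, p.2.2 + p.1 * β p.2.1) : Space)
    fun_prop
  · ext y <;> simp
  · simp

/-- The radial map scales `[0, a]` linearly onto `[0, b]` and is the translation by `-(a - b)`
beyond `a`; using `max` puts both cases into one formula. The inverse has the same shape, and for `a
= b = 0` both maps are the identity. -/
theorem shrink_expand {a b r : ℝ} (hb : 0 ≤ b) (hba : b ≤ a) (hab : 0 < a → 0 < b) (hr : 0 ≤ r) :
    0 ≤ r * (1 - (a - b) / max r a) ∧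
    r * (1 - (a - b) / max r a) *
      (1 + (a - b) / max (r * (1 - (a - b) / max r a)) b) = r := by
  rcases (hb.trans hba).eq_or_lt with ha | ha
  · have hb0 : b = 0 := by linarith
    simp [← ha, hb0, hr]
  · have hb' := hab ha
    rcases le_total r a with h | h
    · rw [max_eq_right h]
      have h1 : r * (1 - (a - b) / a) = r * b / a := by field_simp; ring
      have h2 : r * b / a ≤ b := by
        rw [div_le_iff₀ ha, mul_comm]; exact mul_le_mul_of_nonneg_left h hb
      rw [h1, max_eq_right h2]
      refine ⟨by positivity, ?_⟩
      field_simp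
      ring
    · rw [max_eq_left h]
      have hr' : 0 < r := by linarith
      have h1 : r * (1 - (a - b) / r) = r - (a - b) := by field_simp
      rw [h1, max_eq_left (by linarith)]
      refine ⟨by linarith, ?_⟩
      have : r - (a - b) ≠ 0 := by linarith
      field_simp
      ring

theorem expand_shrink {a b r : ℝ} (hb : 0 ≤ b) (hba : b ≤ a) (hab : 0 < a → 0 < b) (hr : 0 ≤ r) :
    0 ≤ r * (1 + (a - b) / max r b) ∧
    r * (1 + (a - b) / max r b) *
      (1 - (a - b) / max (r * (1 + (a - b) / max r b)) a) = r := by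
  rcases (hb.trans hba).eq_or_lt with ha | ha
  · have hb0 : b = 0 := by linarith
    simp [← ha, hb0, hr]
  · have hb' := hab ha
    rcases le_total r b with h | h
    · rw [max_eq_right h]
      have h1 : r * (1 + (a - b) / b) = r * a / b := by field_simp; ring
      have h2 : r * a / b ≤ a := by
        rw [div_le_iff₀ hb', mul_comm]; exact mul_le_mul_of_nonneg_left h ha.le
      rw [h1, max_eq_right h2]
      refine ⟨by positivity, ?_⟩
      field_simp
      ring
    · rw [max_eq_left h]
      have hr' : 0 < r := by linarith
      have h1 : r * (1 + (a - b) / r) = r + (a - b) := by field_simp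
      rw [h1, max_eq_left (by linarith)]
      refine ⟨by linarith, ?_⟩
      have : r + (a - b) ≠ 0 := by linarith
      field_simp
      ring

/-- In each direction `u`, the distance `a u` from the axis is shrunk to `b u`. -/
theorem ambientIsotopic_shrink {a b : ℂ → ℝ} (ha : Continuous a) (hbc : Continuous b)
    (hb : ∀ u, 0 ≤ b u) (hba : ∀ u, b u ≤ a u) (hab : ∀ u, 0 < a u → 0 < b u) (L : Set Space) :
    AmbientIsotopic L ((fun y : Space => (((1 - (a (y.1 / ‖y.1‖) - b (y.1 / ‖y.1‖)) /
      max ‖y.1‖ (a (y.1 / ‖y.1‖)) : ℝ) * y.1, y.2) : Space)) '' L) := by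
  -- The ball rather than the circle, because on the axis the direction `p / ‖p‖` takes the value
  -- `0`.
  obtain ⟨C, hC⟩ : ∃ C, ∀ u ∈ Metric.closedBall (0 : ℂ) 1, a u ≤ C :=
    ((isCompact_closedBall (0 : ℂ) 1).image ha).bddAbove.imp fun C h u hu => h ⟨u, hu, rfl⟩
  have ha0 : ∀ u, 0 ≤ a u := fun u => (hb u).trans (hba u)
  -- At time `t` the distance `a` is shrunk to `c t`, which lies between `b` and `a`, so the
  -- one-variable lemmas apply at every time.
  set c : unitInterval → ℂ → ℝ := fun t u => a u - t * (a u - b u) with hc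
  have hcb : ∀ t u, b u ≤ c t u := fun t u => by
    have := mul_le_of_le_one_left (sub_nonneg.2 (hba u)) t.2.2
    simp only [hc]; linarith
  have hca : ∀ t u, c t u ≤ a u := fun t u => by
    have := mul_nonneg t.2.1 (sub_nonneg.2 (hba u))
    simp only [hc]; linarith
  have hc0 : ∀ t u, 0 ≤ c t u := fun t u => (hb u).trans (hcb t u)
  have hac : ∀ t u, 0 < a u → 0 < c t u := fun t u h => (hab u h).trans_le (hcb t u)
  have hs : ∀ t (p : ℂ), ‖((1 - (a (p / ‖p‖) - c t (p / ‖p‖)) / max ‖p‖ (a (p / ‖p‖)) : ℝ) : ℂ) * p‖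
      = ‖p‖ * (1 - (a (p / ‖p‖) - c t (p / ‖p‖)) / max ‖p‖ (a (p / ‖p‖))) := fun t p => by
    have h := (shrink_expand (hc0 t (p / ‖p‖)) (hca t _) (hac t _) (norm_nonneg p)).1
    rcases eq_or_ne p 0 with rfl | hp
    · simp
    · rw [norm_mul, Complex.norm_real, mul_comm, Real.norm_of_nonneg]
      exact nonneg_of_mul_nonneg_right h (norm_pos_iff.2 hp)
  have hdir : ∀ (s : ℝ) (p : ℂ), 0 < s → (s : ℂ) * p / ‖(s : ℂ) * p‖ = p / ‖p‖ := fun s p h => by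
    rw [norm_mul, Complex.norm_real, Real.norm_of_nonneg h.le, Complex.ofReal_mul,
      mul_div_mul_left _ _ (by exact_mod_cast h.ne')]
  have hle : ∀ t (p : ℂ), ‖p‖ * (1 - (a (p / ‖p‖) - c t (p / ‖p‖)) / max ‖p‖ (a (p / ‖p‖))) ≤ ‖p‖ :=
    fun t p => by
    refine mul_le_of_le_one_right (norm_nonneg p) (sub_le_self _ (div_nonneg ?_ ?_))
    · exact sub_nonneg.2 (hca t _)
    · exact le_max_of_le_left (norm_nonneg p)
  have key := AmbientIsotopic.of_family (fun t y => (((1 - (a (y.1 / ‖y.1‖) - c t (y.1 / ‖y.1‖)) /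
      max ‖y.1‖ (a (y.1 / ‖y.1‖)) : ℝ) * y.1, y.2) : Space)) ?_ ?_ C ?_ ?_ L
  · simpa [hc] using key
  · refine Continuous.prodMk ?_ (by fun_prop)
    rw [continuous_iff_continuousAt]
    rintro ⟨t, p, z⟩
    by_cases hp : p = 0
    · subst hp
      have h0 : Tendsto (fun y : unitInterval × Space => ‖y.2.1‖) (𝓝 (t, (0, z))) (𝓝 0) := by
        have : Continuous (fun y : unitInterval × Space => ‖y.2.1‖) := by fun_prop
        simpa using this.tendsto (t, (0, z))
      simp only [ContinuousAt, mul_zero]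
      refine squeeze_zero_norm (fun y => ?_) h0
      rw [hs]
      exact hle _ _
    · have h1 : ContinuousAt (fun y : unitInterval × Space => y.2.1 / (‖y.2.1‖ : ℂ)) (t, (p, z)) :=
        ContinuousAt.div (by fun_prop) (by fun_prop) (by simpa using hp)
      have h2 : ContinuousAt (fun y : unitInterval × Space =>
          a (y.2.1 / (‖y.2.1‖ : ℂ))) (t, (p, z)) := ha.continuousAt.comp h1
      have h3 : ContinuousAt (fun y : unitInterval × Space =>
          b (y.2.1 / (‖y.2.1‖ : ℂ))) (t, (p, z)) := hbc.continuousAt.comp h1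
      have h4 : ContinuousAt (fun y : unitInterval × Space =>
          max ‖y.2.1‖ (a (y.2.1 / (‖y.2.1‖ : ℂ)))) (t, (p, z)) :=
        Tendsto.max (ContinuousAt.tendsto (by fun_prop)) h2.tendsto
      have h5 : ContinuousAt (fun y : unitInterval × Space =>
          (a (y.2.1 / (‖y.2.1‖ : ℂ)) - c y.1 (y.2.1 / (‖y.2.1‖ : ℂ))) /
            max ‖y.2.1‖ (a (y.2.1 / (‖y.2.1‖ : ℂ)))) (t, (p, z)) := by
        refine ContinuousAt.div ?_ h4 (lt_max_of_lt_left (norm_pos_iff.2 hp)).ne'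
        simp only [hc]
        fun_prop
      fun_prop
  · intro t
    constructor
    · rintro ⟨p, z⟩ ⟨q, z'⟩ h
      simp only [Prod.mk.injEq] at h
      obtain ⟨h, rfl⟩ := h
      have hp := shrink_expand (hc0 t (p / ‖p‖)) (hca t _) (hac t _) (norm_nonneg p)
      have hq := shrink_expand (hc0 t (q / ‖q‖)) (hca t _) (hac t _) (norm_nonneg q)
      have hn := congrArg norm h
      rw [hs, hs] at hn
      have hz : ∀ {p : ℂ}, p ≠ 0 →
          0 < 1 - (a (p / ‖p‖) - c t (p / ‖p‖)) / max ‖p‖ (a (p / ‖p‖)) := fun {p} hp0 => by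
        have h' := shrink_expand (hc0 t (p / ‖p‖)) (hca t _) (hac t _) (norm_nonneg p)
        have h0 := norm_pos_iff.2 hp0
        refine (nonneg_of_mul_nonneg_right h'.1 h0).lt_of_ne fun h1 => ?_
        have h2 := h'.2
        rw [← h1, mul_zero, zero_mul] at h2
        exact h0.ne h2
      by_cases hp0 : p = 0
      · by_cases hq0 : q = 0
        · rw [hp0, hq0]
        · have := mul_pos (norm_pos_iff.2 hq0) (hz hq0)
          rw [← hn, hp0, norm_zero, zero_mul] at this
          exact absurd this (lt_irrefl _)
      · by_cases hq0 : q = 0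
        · have := mul_pos (norm_pos_iff.2 hp0) (hz hp0)
          rw [hn, hq0, norm_zero, zero_mul] at this
          exact absurd this (lt_irrefl _)
        · have hd : p / ‖p‖ = q / ‖q‖ := by
            rw [← hdir _ p (hz hp0), ← hdir _ q (hz hq0), h]
          have hnn : ‖p‖ = ‖q‖ := by rw [← hp.2, ← hq.2, hn, hd]
          rw [hnn, div_left_inj' (by simpa using hq0)] at hd
          rw [hd]
    · rintro ⟨q, z⟩
      by_cases hq0 : q = 0
      · exact ⟨(0, z), by simp [hq0]⟩
      · have h := expand_shrink (hc0 t (q / ‖q‖)) (hca t _) (hac t _) (norm_nonneg q)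
        set u : ℂ := q / ‖q‖ with hu
        have h0 := norm_pos_iff.2 hq0
        have hm : 0 < 1 + (a u - c t u) / max ‖q‖ (c t u) :=
          add_pos_of_pos_of_nonneg one_pos (div_nonneg (sub_nonneg.2 (hca t u))
            (le_max_of_le_left h0.le))
        refine ⟨(((1 + (a u - c t u) / max ‖q‖ (c t u) : ℝ) : ℂ) * q, z), ?_⟩
        simp only [hdir _ q hm, ← hu, Prod.mk.injEq, and_true]
        rw [norm_mul, Complex.norm_real, Real.norm_of_nonneg hm.le, ← mul_assoc, ← Complex.ofReal_mul,
          mul_comm (1 + (a u - c t u) / max ‖q‖ (c t u)) ‖q‖]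
        have h2 : (1 - (a u - c t u) / max (‖q‖ * (1 + (a u - c t u) / max ‖q‖ (c t u))) (a u)) *
            (1 + (a u - c t u) / max ‖q‖ (c t u)) = 1 := by
          have := h.2
          rw [mul_assoc] at this
          rw [mul_comm]
          exact mul_left_cancel₀ h0.ne' (this.trans (mul_one _).symm)
        rw [h2, Complex.ofReal_one, one_mul]
  · rintro t ⟨p, z⟩
    have h1 : ‖p‖ ≤ ‖p‖ * (1 - (a (p / ‖p‖) - c t (p / ‖p‖)) / max ‖p‖ (a (p / ‖p‖))) + C := by
      have h2 : ‖p‖ / max ‖p‖ (a (p / ‖p‖)) ≤ 1 :=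
        div_le_one_of_le₀ (le_max_left _ _) (le_max_of_le_left (norm_nonneg p))
      have h3 := mul_le_of_le_one_left (sub_nonneg.2 (hca t (p / ‖p‖))) h2
      have h4 : a (p / ‖p‖) ≤ C := hC _ (by
        rw [mem_closedBall_zero_iff, norm_div, Complex.norm_real, norm_norm]
        exact div_self_le_one _)
      have h5 : ‖p‖ * (1 - (a (p / ‖p‖) - c t (p / ‖p‖)) / max ‖p‖ (a (p / ‖p‖))) =
        ‖p‖ - ‖p‖ / max ‖p‖ (a (p / ‖p‖)) * (a (p / ‖p‖) - c t (p / ‖p‖)) := by ring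
      have h6 := hc0 t (p / ‖p‖)
      linarith
    have hC0 : 0 ≤ C := (ha0 0).trans (hC 0 (by simp))
    simp only [Prod.norm_def, hs]
    exact max_le (h1.trans (by gcongr; exact le_max_left _ _))
      ((le_max_right _ _).trans (le_add_of_nonneg_right hC0))
  · rintro ⟨p, z⟩
    simp [hc]

/-! ### Curves whose points all have different directions. -/

section Petals

variable {n : ℕ} {κ : Fin n → unitInterval → ℂ}

/-- Over curves that meet only at the axis, the heights can be changed away from the axis. -/
theorem ambientIsotopic_sweep_height (hκ : ∀ k, Continuous (κ k)) (hn : ∀ k t, ‖κ k t‖ = 1)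
    (hinj : Function.Injective fun q : Fin n × unitInterval => κ q.1 q.2)
    {r z z' : Fin n → unitInterval → ℝ} (hr : ∀ k, Continuous (r k)) (hz : ∀ k, Continuous (z k))
    (hz' : ∀ k, Continuous (z' k)) (hr0 : ∀ k t, 0 ≤ r k t)
    (hzz : ∀ k t, r k t = 0 → z k t = z' k t) :
    AmbientIsotopic (sweep κ fun k t => (r k t, z k t)) (sweep κ fun k t => (r k t, z' k t)) := by
  -- The change of height is a function of the horizontal projection: off the axis this projection
  -- is injective, and on the axis the change is zero.
  obtain ⟨β, hβ⟩ := exists_continuous_extension_of_factorsThrough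
    (X := Fin n × unitInterval) (φ := fun q => (r q.1 q.2 : ℂ) * κ q.1 q.2)
    (f := fun q => z' q.1 q.2 - z q.1 q.2)
    (continuous_prod_of_discrete_left.2 fun k => by
      exact (Complex.continuous_ofReal.comp (hr k)).mul (hκ k))
    (continuous_prod_of_discrete_left.2 fun k => (hz' k).sub (hz k)) (by
      rintro ⟨j, s⟩ ⟨k, t⟩ h
      simp only at h
      have h1 : r j s = r k t := by
        have := congrArg norm h
        simpa [hn, abs_of_nonneg (hr0 _ _)] using this
      by_cases h0 : r k t = 0
      · have h0' := h1.trans h0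
        simp [hzz _ _ h0, hzz _ _ h0']
      · rw [h1] at h
        have := @hinj (j, s) (k, t) (mul_left_cancel₀ (by exact_mod_cast h0) h)
        rw [this])
  convert ambientIsotopic_shear β (sweep κ fun k t => (r k t, z k t)) using 1
  rw [sweep, sweep, ← Set.range_comp]
  congr 1
  funext q
  simp only [Function.comp_apply, Prod.mk.injEq, true_and]
  rw [hβ q]
  ring

/-- Curves that meet only at the axis can be shrunk towards the axis. -/
theorem ambientIsotopic_sweep_radius (hκ : ∀ k, Continuous (κ k)) (hn : ∀ k t, ‖κ k t‖ = 1)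
    (hinj : Function.Injective fun q : Fin n × unitInterval => κ q.1 q.2)
    {r r' z : Fin n → unitInterval → ℝ} (hr : ∀ k, Continuous (r k)) (hr' : ∀ k, Continuous (r' k))
    (hr0 : ∀ k t, 0 ≤ r' k t) (hrr : ∀ k t, r' k t ≤ r k t) (hpos : ∀ k t, 0 < r k t → 0 < r' k t) :
    AmbientIsotopic (sweep κ fun k t => (r k t, z k t)) (sweep κ fun k t => (r' k t, z k t)) := by
  rcases isEmpty_or_nonempty (Fin n) with hE | hE
  · simp only [sweep, Set.range_eq_empty]
    exact AmbientIsotopic.refl _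
  have hκ' : Continuous fun q : Fin n × unitInterval => κ q.1 q.2 :=
    continuous_prod_of_discrete_left.2 hκ
  obtain ⟨α, hα⟩ := exists_continuous_extension_of_factorsThrough
    (X := Fin n × unitInterval) hκ' (f := fun q => r q.1 q.2)
    (continuous_prod_of_discrete_left.2 hr) (fun x x' h => by rw [hinj h])
  obtain ⟨α', hα'⟩ := exists_continuous_extension_of_factorsThrough
    (X := Fin n × unitInterval) hκ' (f := fun q => r' q.1 q.2)
    (continuous_prod_of_discrete_left.2 hr') (fun x x' h => by rw [hinj h])
  set S : Set ℂ := Set.range fun q : Fin n × unitInterval => κ q.1 q.2 with hS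
  have hSc : IsClosed S := (isCompact_range hκ').isClosed
  have hSn : S.Nonempty := Set.range_nonempty _
  have hmem : ∀ k t, κ k t ∈ S := fun k t => ⟨(k, t), rfl⟩
  -- The distance to `S` makes both functions positive off `S` without changing them on `S`, so that
  -- `0 < a u → 0 < b u` holds in every direction.
  set a : ℂ → ℝ := fun u => |α u| + Metric.infDist u S with ha
  set b : ℂ → ℝ := fun u => min (a u) (|α' u| + Metric.infDist u S) with hb
  have hd := Metric.continuous_infDist_pt S
  have hac : Continuous a := by simp only [ha]; fun_prop
  have hbc : Continuous b := by simp only [hb]; fun_prop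
  have haκ : ∀ k t, a (κ k t) = r k t := fun k t => by
    simp only [ha]
    rw [hα (k, t), Metric.infDist_zero_of_mem (hmem k t), add_zero,
      abs_of_nonneg ((hr0 k t).trans (hrr k t))]
  have hbκ : ∀ k t, b (κ k t) = r' k t := fun k t => by
    simp only [hb]
    rw [haκ, hα' (k, t), Metric.infDist_zero_of_mem (hmem k t), add_zero,
      abs_of_nonneg (hr0 k t), min_eq_right (hrr k t)]
  have key := ambientIsotopic_shrink hac hbc (fun u => by
      simp only [hb, ha]
      have := Metric.infDist_nonneg (x := u) (s := S)
      positivity) (fun u => min_le_left _ _) (fun u hu => by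
        refine lt_min hu ?_
        rcases (Metric.infDist_nonneg (x := u) (s := S)).eq_or_lt with h | h
        · obtain ⟨⟨k, t⟩, rfl⟩ := (hSc.mem_iff_infDist_zero hSn).2 h.symm
          simp only [haκ] at hu
          rw [hα' (k, t), ← h, add_zero, abs_of_nonneg (hr0 k t)]
          exact hpos _ _ hu
        · positivity) (sweep κ fun k t => (r k t, z k t))
  convert key using 1
  rw [sweep, sweep, ← Set.range_comp]
  congr 1
  funext ⟨k, t⟩
  simp only [Function.comp_apply, Prod.mk.injEq, and_true]
  have h0 : 0 ≤ r k t := (hr0 k t).trans (hrr k t)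
  rw [norm_mul, hn, mul_one, Complex.norm_real, Real.norm_of_nonneg h0]
  rcases h0.eq_or_lt with h | h
  · have : r' k t = 0 := le_antisymm ((hrr k t).trans h.symm.le) (hr0 k t)
    simp [← h, this]
  · have h3 : (r k t : ℂ) ≠ 0 := by exact_mod_cast h.ne'
    rw [mul_div_cancel_left₀ _ h3, haκ, hbκ, max_self, ← mul_assoc, ← Complex.ofReal_mul]
    congr 2
    field_simp
    ring

/-- Two systems of curves over the same directions, with the same points on the axis, are
isotopic. -/
theorem ambientIsotopic_sweep_of_axis (hκ : ∀ k, Continuous (κ k)) (hn : ∀ k t, ‖κ k t‖ = 1)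
    (hinj : Function.Injective fun q : Fin n × unitInterval => κ q.1 q.2)
    {f f' : Fin n → unitInterval → ℝ × ℝ} (hf : ∀ k, Continuous (f k)) (hf' : ∀ k, Continuous (f' k))
    (h0 : ∀ k t, 0 ≤ (f k t).1) (h0' : ∀ k t, 0 ≤ (f' k t).1)
    (hax : ∀ k t, (f k t).1 = 0 ↔ (f' k t).1 = 0)
    (hz : ∀ k t, (f k t).1 = 0 → (f k t).2 = (f' k t).2) :
    AmbientIsotopic (sweep κ f) (sweep κ f') := by
  have hmin : ∀ k t, 0 < (f k t).1 → 0 < (f' k t).1 := fun k t h =>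
    (h0' k t).lt_of_ne fun h' => h.ne' ((hax k t).2 h'.symm)
  have hmin' : ∀ k t, 0 < (f' k t).1 → 0 < (f k t).1 := fun k t h =>
    (h0 k t).lt_of_ne fun h' => h.ne' ((hax k t).1 h'.symm)
  have h1 : AmbientIsotopic (sweep κ f) (sweep κ fun k t => ((f k t).1, (f' k t).2)) :=
    ambientIsotopic_sweep_height hκ hn hinj (r := fun k t => (f k t).1)
      (fun k => (hf k).fst) (fun k => (hf k).snd) (fun k => (hf' k).snd) h0 hz
  -- Radii can only be shrunk, so both systems are brought to the minimum of their radii.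
  have h2 : AmbientIsotopic (sweep κ fun k t => ((f k t).1, (f' k t).2))
      (sweep κ fun k t => (min (f k t).1 (f' k t).1, (f' k t).2)) :=
    ambientIsotopic_sweep_radius hκ hn hinj (fun k => (hf k).fst)
      (fun k => (hf k).fst.min (hf' k).fst) (fun k t => le_min (h0 k t) (h0' k t))
      (fun k t => min_le_left _ _) (fun k t h => lt_min h (hmin k t h))
  have h3 : AmbientIsotopic (sweep κ f')
      (sweep κ fun k t => (min (f k t).1 (f' k t).1, (f' k t).2)) :=
    ambientIsotopic_sweep_radius hκ hn hinj (z := fun k t => (f' k t).2) (fun k => (hf' k).fst)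
      (fun k => (hf k).fst.min (hf' k).fst) (fun k t => le_min (h0 k t) (h0' k t))
      (fun k t => min_le_right _ _) (fun k t h => lt_min (hmin' k t h) h)
  exact (h1.trans h2).trans h3.symm

end Petals

/-! ### Replacing arcs within pages and moving the pages. -/

/-- Pages at distinct directions: the arcs in the pages can be replaced by arcs with the same end
points. -/
theorem ambientIsotopic_sweep_arcs {n : ℕ} {e : Fin n → ℂ} (he : ∀ k, ‖e k‖ = 1)
    (hinj : Function.Injective e) {f f' : Fin n → unitInterval → ℝ × ℝ}
    (hf : ∀ k, Continuous (f k)) (hf' : ∀ k, Continuous (f' k))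
    (hfi : ∀ k, Function.Injective (f k)) (hfi' : ∀ k, Function.Injective (f' k))
    (h0 : ∀ k t, 0 ≤ (f k t).1) (h0' : ∀ k t, 0 ≤ (f' k t).1)
    (hax : ∀ k t, (f k t).1 = 0 ↔ (f' k t).1 = 0)
    (hz : ∀ k t, (f k t).1 = 0 → (f k t).2 = (f' k t).2) :
    AmbientIsotopic (sweep (fun k _ => e k) f) (sweep (fun k _ => e k) f') := by
  obtain ⟨δ, hδ, hδe⟩ := exists_pos_forall_ne_le (fun j k => ‖e j - e k‖)
    (fun j k h => norm_pos_iff.2 (sub_ne_zero.2 (hinj.ne h)))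
  obtain ⟨ε₀, hε₀, hrot⟩ := exists_ambientIsotopic_sweep_rotate he hinj
  set ε := min ε₀ (min 1 (δ / 2)) with hε
  have hεpos : 0 < ε := by positivity
  have hε1 : ε ≤ 1 := (min_le_right _ _).trans (min_le_left _ _)
  have hεδ : ε ≤ δ / 2 := (min_le_right _ _).trans (min_le_right _ _)
  -- The fan of page `k`: the point at parameter `t` is turned by `ε (t - 1/2)`. Fans of different
  -- pages are disjoint because `ε ≤ δ / 2`, and within one fan the angle, being small, determines
  -- `t`.
  set κ : Fin n → unitInterval → ℂ := fun k t =>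
    e k * Complex.exp (Complex.I * ((ε * (t - 1 / 2) : ℝ) : ℂ)) with hκ
  have hκc : ∀ k, Continuous (κ k) := fun k => by simp only [hκ]; fun_prop
  have hκn : ∀ k t, ‖κ k t‖ = 1 := fun k t => by
    simp only [hκ]; rw [norm_mul_exp_I_mul_ofReal, he]
  have hκi : Function.Injective fun q : Fin n × unitInterval => κ q.1 q.2 := by
    rintro ⟨j, s⟩ ⟨k, t⟩ h
    simp only [hκ] at h
    have hs := s.2
    have ht := t.2
    have hst : |ε * (t - 1 / 2) - ε * (s - 1 / 2)| ≤ ε := by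
      rw [← mul_sub, abs_mul, abs_of_pos hεpos]
      refine mul_le_of_le_one_right hεpos.le (abs_le.2 ?_)
      constructor <;> linarith [hs.1, hs.2, ht.1, ht.2]
    have hjk : j = k := by
      by_contra hne
      have h1 : (e j - e k) * Complex.exp (Complex.I * ((ε * (s - 1 / 2) : ℝ) : ℂ)) =
          e k * (Complex.exp (Complex.I * ((ε * (t - 1 / 2) : ℝ) : ℂ)) -
            Complex.exp (Complex.I * ((ε * (s - 1 / 2) : ℝ) : ℂ))) := by
        rw [sub_mul, h]; ring
      have h2 := congrArg norm h1
      rw [norm_mul_exp_I_mul_ofReal, norm_mul, he, one_mul] at h2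
      have h3 := norm_exp_I_mul_sub_exp_I_mul_le (ε * (t - 1 / 2)) (ε * (s - 1 / 2))
      have := hδe j k hne
      linarith
    subst hjk
    have hej : e j ≠ 0 := by rw [← norm_ne_zero_iff, he]; exact one_ne_zero
    have h4 := mul_left_cancel₀ hej h
    have hb : ∀ s : unitInterval, -Real.pi < ε * (s - 1 / 2) ∧ ε * (s - 1 / 2) ≤ Real.pi := fun s => by
      have h5 : |ε * ((s : ℝ) - 1 / 2)| ≤ 1 := by
        rw [abs_mul, abs_of_pos hεpos]
        refine mul_le_one₀ hε1 (abs_nonneg _) (abs_le.2 ?_)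
        constructor <;> linarith [s.2.1, s.2.2]
      have h6 := abs_le.1 h5
      have h7 := Real.pi_gt_three
      constructor <;> linarith
    have h5 := Complex.exp_inj_of_neg_pi_lt_of_le_pi (by simpa using! (hb s).1)
      (by simpa using! (hb s).2) (by simpa using! (hb t).1) (by simpa using! (hb t).2) h4
    have h6 : (ε * (s - 1 / 2) : ℝ) = ε * (t - 1 / 2) := by
      exact_mod_cast mul_left_cancel₀ Complex.I_ne_zero h5
    have h7 := mul_left_cancel₀ hεpos.ne' h6
    have : s = t := Subtype.ext (by linarith)
    rw [this]
  have lift : ∀ f : Fin n → unitInterval → ℝ × ℝ, (∀ k, Continuous (f k)) →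
      (∀ k, Function.Injective (f k)) → (∀ k t, 0 ≤ (f k t).1) →
      AmbientIsotopic (sweep (fun k _ => e k) f) (sweep κ f) := by
    intro f hf hfi h0
    -- Each arc is injective, so its parameter is a continuous function on it and extends to the
    -- page; clamping to `[0, 1]` keeps the rotation small.
    have h1 : ∀ k, ∃ g : C(ℝ × ℝ, ℝ), ∀ t, g (f k t) = (t : ℝ) := fun k =>
      exists_continuous_extension_of_factorsThrough (hf k) continuous_subtype_val
        (fun x x' h => by rw [hfi k h])
    choose g hg using h1
    have h2 := hrot (fun k => ⟨fun x => ε * (max 0 (min 1 (g k x)) - 1 / 2), by fun_prop⟩)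
      (fun k x => by
        simp only [ContinuousMap.coe_mk]
        rw [abs_mul, abs_of_pos hεpos]
        refine (mul_le_of_le_one_right hεpos.le (abs_le.2 ?_)).trans (min_le_left _ _)
        have h3 : max 0 (min 1 (g k x)) ≤ 1 := max_le zero_le_one (min_le_left _ _)
        have h4 : 0 ≤ max 0 (min 1 (g k x)) := le_max_left _ _
        constructor <;> linarith) unitInterval f h0
    convert h2 using 2
    funext k t
    simp only [hκ, ContinuousMap.coe_mk]
    rw [hg, min_eq_right t.2.2, max_eq_right t.2.1]
  exact ((lift f hf hfi h0).trans (ambientIsotopic_sweep_of_axis hκc hκn hκi hf hf' h0 h0' hax hz)).trans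
    (lift f' hf' hfi' h0').symm

theorem injective_exp_mul_I_of_strictMono {n : ℕ} {θ : Fin n → ℝ} (hθ : StrictMono θ)
    (h0 : ∀ k, 0 ≤ θ k) (h1 : ∀ k, θ k < 2 * Real.pi) :
    Function.Injective fun k => Complex.exp (θ k * Complex.I) := by
  intro j k h
  refine hθ.injective (Circle.exp_injOn_Ico (by simp) ⟨h0 j, h1 j⟩ ⟨h0 k, h1 k⟩ ?_)
  ext
  simpa using h

/-- Pages can be moved around the axis. -/
theorem ambientIsotopic_sweep_angles {n : ℕ} {θ θ' : Fin n → ℝ} (hθ : StrictMono θ)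
    (h0 : ∀ k, 0 ≤ θ k) (h1 : ∀ k, θ k < 2 * Real.pi) (hθ' : StrictMono θ')
    (h0' : ∀ k, 0 ≤ θ' k) (h1' : ∀ k, θ' k < 2 * Real.pi) {X : Type}
    {f : Fin n → X → ℝ × ℝ} (hf : ∀ k x, 0 ≤ (f k x).1) :
    AmbientIsotopic (sweep (fun k _ => Complex.exp (θ k * Complex.I)) f)
      (sweep (fun k _ => Complex.exp (θ' k * Complex.I)) f) := by
  let s : Setoid (Set Space) :=
    ⟨AmbientIsotopic, AmbientIsotopic.refl, AmbientIsotopic.symm, AmbientIsotopic.trans⟩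
  set φ : unitInterval → Fin n → ℝ := fun t k => (1 - t) * θ k + t * θ' k with hφ
  -- Small rotations of the pages are isotopies, so along the linear interpolation of the angles the
  -- isotopy class is locally constant, hence constant on the interval. The pages stay distinct
  -- since their order is kept.
  have hc : IsLocallyConstant fun t : unitInterval =>
      (⟦sweep (fun k _ => Complex.exp (φ t k * Complex.I)) f⟧ : Quotient s) := by
    rw [IsLocallyConstant.iff_eventually_eq]
    intro t
    have ht0 := t.2.1
    have ht1 : 0 ≤ 1 - (t : ℝ) := sub_nonneg.2 t.2.2
    have hmono : StrictMono (φ t) := fun j k h => by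
      have a1 := hθ h
      have a2 := hθ' h
      simp only [hφ]
      rcases ht0.eq_or_lt with h' | h'
      · rw [← h']; linarith
      · have := mul_lt_mul_of_pos_left a2 h'
        have := mul_le_mul_of_nonneg_left a1.le ht1
        linarith
    have hinj := injective_exp_mul_I_of_strictMono hmono
      (fun k => add_nonneg (mul_nonneg ht1 (h0 k)) (mul_nonneg ht0 (h0' k))) (fun k => by
        simp only [hφ]
        rcases ht0.eq_or_lt with h' | h'
        · rw [← h']; linarith [h1 k]
        · have := mul_lt_mul_of_pos_left (h1' k) h'
          have := mul_le_mul_of_nonneg_left (h1 k).le ht1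
          linarith)
    obtain ⟨ε, hε, hrot⟩ := exists_ambientIsotopic_sweep_rotate
      (fun k => Complex.norm_exp_ofReal_mul_I _) hinj
    have hev : ∀ᶠ t' in 𝓝 t, ∀ k, |φ t' k - φ t k| ≤ ε := by
      rw [eventually_all]
      intro k
      have hcont : Continuous fun t' => |φ t' k - φ t k| := by simp only [hφ]; fun_prop
      have := hcont.tendsto t
      rw [sub_self, abs_zero] at this
      exact this.eventually (Iic_mem_nhds hε)
    filter_upwards [hev] with t' ht'
    refine Quotient.sound (AmbientIsotopic.symm ?_)
    convert hrot (fun k => ContinuousMap.const _ (φ t' k - φ t k)) (fun k _ => ht' k) X f hf using 2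
    funext k x
    rw [ContinuousMap.const_apply, ← Complex.exp_add]
    push_cast
    ring_nf
  have h := Quotient.exact (hc.apply_eq_of_preconnectedSpace 0 1)
  simpa [hφ] using! h

/-! ### Arc-presentations up to isotopy. -/

namespace ArcPresentation

variable {n : ℕ}

theorem carrier_eq_sweep (A : ArcPresentation n) :
    A.carrier = sweep (fun k _ => Complex.exp (A.angle k * Complex.I)) A.arc := by
  ext y
  simp [carrier, sweep]

theorem arc_fst_eq_zero_iff (A : ArcPresentation n) (k : Fin n) (t : unitInterval) :
    (A.arc k t).1 = 0 ↔ t = 0 ∨ t = 1 := by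
  constructor
  · intro h
    by_contra! h'
    exact (A.arc_pos k t (unitInterval.pos_iff_ne_zero.2 h'.1)
      (unitInterval.lt_one_iff_ne_one.2 h'.2)).ne' h
  · rintro (rfl | rfl)
    exacts [A.arc_zero k, A.arc_one k]

theorem arc_fst_nonneg (A : ArcPresentation n) (k : Fin n) (t : unitInterval) :
    0 ≤ (A.arc k t).1 := by
  by_cases h : t = 0 ∨ t = 1
  · exact ((A.arc_fst_eq_zero_iff k t).2 h).ge
  · push Not at h
    exact (A.arc_pos k t (unitInterval.pos_iff_ne_zero.2 h.1)
      (unitInterval.lt_one_iff_ne_one.2 h.2)).le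

/-- An arc-presentation is determined up to isotopy by its points on the axis and the order in which
its arcs join them. -/
theorem ambientIsotopic_carrier {A B : ArcPresentation n} (hnext : A.next = B.next)
    (hstart : ∀ k, (A.arc k 0).2 = (B.arc k 0).2) : AmbientIsotopic A.carrier B.carrier := by
  rw [carrier_eq_sweep, carrier_eq_sweep]
  refine (ambientIsotopic_sweep_angles A.angle_strictMono A.angle_nonneg A.angle_lt
    B.angle_strictMono B.angle_nonneg B.angle_lt A.arc_fst_nonneg).trans ?_
  refine ambientIsotopic_sweep_arcs (fun k => Complex.norm_exp_ofReal_mul_I _)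
    (injective_exp_mul_I_of_strictMono B.angle_strictMono B.angle_nonneg B.angle_lt)
    A.arc_continuous B.arc_continuous A.arc_injective B.arc_injective A.arc_fst_nonneg
    B.arc_fst_nonneg (fun k t => by rw [arc_fst_eq_zero_iff, arc_fst_eq_zero_iff]) (fun k t h => ?_)
  rcases (A.arc_fst_eq_zero_iff k t).1 h with rfl | rfl
  · exact hstart k
  · rw [← A.arc_next, ← B.arc_next, hstart, hnext]

end ArcPresentation

/-! ### Trigonometric inequalities for the width. -/

/-- Modulo `π` the angle lies in `[π/n, π - π/n]`, where the sine is smallest at the ends. -/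
theorem sin_pi_div_le_abs_sin {n : ℕ} (hn : 0 < n) {c : ℤ} (hc : ¬ (n : ℤ) ∣ c) :
    Real.sin (Real.pi / n) ≤ |Real.sin (Real.pi * c / n)| := by
  have hn' : (0 : ℝ) < n := by exact_mod_cast hn
  have hpi := Real.pi_pos
  have hnz : (0 : ℤ) < n := by exact_mod_cast hn
  set r := c % n with hr
  have hr0 : 0 < r := (Int.emod_nonneg _ hnz.ne').lt_of_ne fun h => hc (Int.dvd_of_emod_eq_zero h.symm)
  have hrn : r < n := Int.emod_lt_of_pos _ hnz
  have hcr : Real.pi * c / n = Real.pi * r / n + (c / n : ℤ) * Real.pi := by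
    have h : (c : ℝ) = r + n * (c / n : ℤ) := by
      exact_mod_cast (Int.emod_add_mul_ediv c n).symm
    rw [h]; field_simp
  rw [hcr, Real.sin_add_int_mul_pi, abs_mul, abs_zpow, abs_neg, abs_one, one_zpow, one_mul]
  have h1 : (1 : ℝ) ≤ r := by exact_mod_cast hr0
  have h2 : (r : ℝ) + 1 ≤ n := by exact_mod_cast hrn
  refine le_trans ?_ (le_abs_self _)
  have h3 : Real.pi / n ≤ Real.pi * r / n := by
    gcongr; nlinarith
  have h4 : Real.pi * r / n ≤ Real.pi - Real.pi / n := by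
    rw [div_le_iff₀ hn', sub_mul, div_mul_cancel₀ _ hn'.ne']; nlinarith
  rcases le_total (Real.pi * r / n) (Real.pi / 2) with h | h
  · exact Real.sin_le_sin_of_le_of_le_pi_div_two (by have : 0 < Real.pi / n := by positivity
                                                     linarith) h h3
  · rw [← Real.sin_pi_sub (Real.pi * r / n)]
    exact Real.sin_le_sin_of_le_of_le_pi_div_two (by have : 0 < Real.pi / n := by positivity
                                                     linarith) (by linarith) (by linarith)

theorem cos_pi_div_nonneg {n : ℕ} (hn : 2 ≤ n) : 0 ≤ Real.cos (Real.pi / n) := by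
  have hn' : (2 : ℝ) ≤ n := by exact_mod_cast hn
  have hpi := Real.pi_pos
  apply Real.cos_nonneg_of_neg_pi_div_two_le_of_le
  · have : 0 ≤ Real.pi / n := by positivity
    linarith
  · gcongr

theorem sin_pi_div_pos {n : ℕ} (hn : 2 ≤ n) : 0 < Real.sin (Real.pi / n) := by
  have hn' : (2 : ℝ) ≤ n := by exact_mod_cast hn
  have hpi := Real.pi_pos
  exact Real.sin_pos_of_pos_of_lt_pi (by positivity) (div_lt_self hpi (by linarith))

theorem abs_cos_le_cos_pi_div {n : ℕ} (hn : 2 ≤ n) {c : ℤ} (hc : ¬ (n : ℤ) ∣ c) :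
    |Real.cos (Real.pi * c / n)| ≤ Real.cos (Real.pi / n) := by
  have h1 := sin_pi_div_le_abs_sin (by omega) hc
  have h2 := sin_pi_div_pos hn
  have h3 := Real.sin_sq_add_cos_sq (Real.pi / n)
  have h4 := Real.sin_sq_add_cos_sq (Real.pi * c / n)
  have h5 := cos_pi_div_nonneg hn
  rw [← sq_abs (Real.sin (Real.pi * c / n))] at h4
  exact abs_le_of_sq_le_sq (by nlinarith) h5

/-- Passing to denominator `2n` is the source of `π/(2α)` in the odd case: for odd `n` the numerator
`n - 2c` is odd, hence not a multiple of `2n`, and the bounds for sine and cosine apply with `2n`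
for `n`. -/
theorem abs_cos_eq_abs_sin (n : ℕ) (hn : 0 < n) (c : ℤ) :
    |Real.cos (Real.pi * c / n)| =
      |Real.sin (Real.pi * ((n - 2 * c : ℤ) : ℝ) / ((2 * n : ℕ) : ℝ))| := by
  have hn' : (0 : ℝ) < n := by exact_mod_cast hn
  rw [← Real.sin_pi_div_two_sub]
  congr 2
  push_cast
  field_simp

theorem abs_sin_eq_abs_cos (n : ℕ) (hn : 0 < n) (c : ℤ) :
    |Real.sin (Real.pi * c / n)| =
      |Real.cos (Real.pi * ((n - 2 * c : ℤ) : ℝ) / ((2 * n : ℕ) : ℝ))| := by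
  have hn' : (0 : ℝ) < n := by exact_mod_cast hn
  rw [← Real.cos_pi_div_two_sub]
  congr 2
  push_cast
  field_simp

/-- The half-widths `H` for which a ribbon along `n` spokes of length one is narrow enough. -/
def IsNarrow (n : ℕ) (H : ℝ) : Prop :=
  (Even n → H * Real.cos (Real.pi / n) < Real.sin (Real.pi / n)) ∧
    (¬ Even n → H * Real.cos (Real.pi / (2 * n : ℕ)) < Real.sin (Real.pi / (2 * n : ℕ)))

namespace IsNarrow

variable {n : ℕ} {H : ℝ}

/-- The odd condition is the stronger one, since `tan (π/(2n)) ≤ tan (π/n)`; stated without division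
it also covers `n = 2`, where the cosine is zero. -/
theorem mul_cos_lt (h : IsNarrow n H) (hn : 2 ≤ n) (hH : 0 ≤ H) :
    H * Real.cos (Real.pi / n) < Real.sin (Real.pi / n) := by
  by_cases he : Even n
  · exact h.1 he
  · have hn' : (2 : ℝ) ≤ n := by exact_mod_cast hn
    have hpi := Real.pi_pos
    have h1 := h.2 he
    have h2 : Real.pi / (2 * n : ℕ) ≤ Real.pi / n := by
      gcongr; omega
    have h3 : Real.pi / n ≤ Real.pi / 2 := by gcongr
    have h0 : 0 ≤ Real.pi / (2 * n : ℕ) := by positivity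
    have h4 := Real.cos_le_cos_of_nonneg_of_le_pi h0 (by linarith) h2
    have h5 := Real.sin_le_sin_of_le_of_le_pi_div_two (by linarith) h3 h2
    calc _ ≤ _ := mul_le_mul_of_nonneg_left h4 hH
      _ < _ := h1
      _ ≤ _ := h5

theorem mul_abs_cos_lt (h : IsNarrow n H) (hn : 2 ≤ n) (hH : 0 ≤ H) {a : ℤ} (ha : ¬ (n : ℤ) ∣ a) :
    H * |Real.cos (Real.pi * a / n)| < |Real.sin (Real.pi * a / n)| :=
  calc _ ≤ _ := mul_le_mul_of_nonneg_left (abs_cos_le_cos_pi_div hn ha) hH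
    _ < _ := h.mul_cos_lt hn hH
    _ ≤ _ := sin_pi_div_le_abs_sin (by omega) ha

theorem sin_le_cos_and {n : ℕ} (hn : 4 ≤ n) :
    Real.sin (Real.pi / n) ≤ Real.cos (Real.pi / n) ∧ 1 ≤ 2 * Real.cos (Real.pi / n) ^ 2 := by
  have hn' : (4 : ℝ) ≤ n := by exact_mod_cast hn
  have hpi := Real.pi_pos
  have h0 : 0 ≤ Real.pi / n := by positivity
  have h1 : Real.pi / n ≤ Real.pi / 4 := by gcongr
  have h2 := Real.cos_le_cos_of_nonneg_of_le_pi h0 (by linarith) h1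
  have h3 := Real.sin_le_sin_of_le_of_le_pi_div_two (by linarith) (by linarith) h1
  rw [Real.cos_pi_div_four] at h2
  rw [Real.sin_pi_div_four] at h3
  have h4 : (√2) ^ 2 = 2 := Real.sq_sqrt (by norm_num)
  have h5 := Real.sqrt_nonneg 2
  exact ⟨h3.trans h2, by nlinarith⟩

theorem not_dvd_of_odd (hne : ¬ Even n) (c : ℤ) : ¬ ((2 * n : ℕ) : ℤ) ∣ (n - 2 * c : ℤ) := by
  rintro ⟨x, hx⟩
  apply hne
  have : (n : ℤ) = 2 * (c + n * x) := by push_cast at hx; linarith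
  exact (Int.even_coe_nat n).1 ⟨c + n * x, by linarith⟩

theorem cos_ne_zero_of_odd (hn : 2 ≤ n) (hne : ¬ Even n) (c : ℤ) :
    Real.cos (Real.pi * c / n) ≠ 0 := by
  have h1 := sin_pi_div_le_abs_sin (n := 2 * n) (by omega) (not_dvd_of_odd hne c)
  rw [← abs_cos_eq_abs_sin n (by omega)] at h1
  have h2 := sin_pi_div_pos (n := 2 * n) (by omega)
  exact abs_pos.1 (h2.trans_le h1)

/-- The end of a central fold of half-length `H / |cos (π d / n)|`, projected to the spoke `a` steps
away, must have absolute value below one. For odd `n` the extreme values of sine and cosine give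
exactly the odd bound; for even `n` they do so unless the sine is `±1`. -/
theorem mul_abs_sin_lt (h : IsNarrow n H) (hn : 2 ≤ n) (hH : 0 ≤ H) {d : ℤ} (hd : ¬ (n : ℤ) ∣ d)
    (hcos : Real.cos (Real.pi * d / n) ≠ 0) (a : ℤ) :
    H * |Real.sin (Real.pi * ((2 * a - d : ℤ) : ℝ) / n)| < |Real.cos (Real.pi * d / n)| := by
  by_cases he : Even n
  · obtain ⟨m, rfl⟩ := he
    rw [← two_mul] at *
    have hm : 0 < m := by omega
    have hm' : (0 : ℝ) < m := by exact_mod_cast hm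
    have hc : |Real.cos (Real.pi * d / (2 * m : ℕ))| =
        |Real.sin (Real.pi * ((m - d : ℤ) : ℝ) / (2 * m : ℕ))| := by
      rw [← Real.sin_pi_div_two_sub]
      congr 2
      push_cast
      field_simp
    have hs : |Real.sin (Real.pi * ((2 * a - d : ℤ) : ℝ) / (2 * m : ℕ))| =
        |Real.cos (Real.pi * ((m - (2 * a - d) : ℤ) : ℝ) / (2 * m : ℕ))| := by
      rw [← Real.cos_pi_div_two_sub]
      congr 2
      push_cast
      field_simp
    have hnd : ¬ ((2 * m : ℕ) : ℤ) ∣ (m - d : ℤ) := by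
      rintro ⟨x, hx⟩
      rw [← abs_pos, hc, hx, abs_pos] at hcos
      apply hcos
      rw [show Real.pi * ((((2 * m : ℕ) : ℤ) * x : ℤ) : ℝ) / (2 * m : ℕ) = x * Real.pi by
        push_cast; field_simp]
      exact Real.sin_int_mul_pi x
    by_cases hb : ((2 * m : ℕ) : ℤ) ∣ (m - (2 * a - d) : ℤ)
    · obtain ⟨x, hx⟩ := hb
      set f : ℤ := m * x + a - d with hf
      have hf2 : (m - d : ℤ) = 2 * f := by push_cast at hx; linarith
      have hmf : ¬ (m : ℤ) ∣ f := fun ⟨y, hy⟩ => hnd ⟨y, by rw [hf2, hy]; push_cast; ring⟩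
      have hm2 : 2 ≤ m := by
        by_contra hlt
        have : m = 1 := by omega
        subst this
        simp at hmf
      have h1 := sin_pi_div_le_abs_sin hm hmf
      have h2 : |Real.cos (Real.pi * d / (2 * m : ℕ))| = |Real.sin (Real.pi * f / m)| := by
        rw [hc, hf2]
        congr 2
        push_cast
        field_simp
      have h3 : Real.sin (Real.pi / m) =
          2 * Real.sin (Real.pi / (2 * m : ℕ)) * Real.cos (Real.pi / (2 * m : ℕ)) := by
        rw [← Real.sin_two_mul]
        congr 1
        push_cast
        field_simp
      have h4 := (sin_le_cos_and (n := 2 * m) (by omega)).2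
      have h5 := h.mul_cos_lt hn hH
      have h6 : 0 < Real.cos (Real.pi / (2 * m : ℕ)) :=
        (cos_pi_div_nonneg hn).lt_of_ne fun h' => by rw [← h'] at h4; norm_num at h4
      calc _ ≤ H * 1 := mul_le_mul_of_nonneg_left (Real.abs_sin_le_one _) hH
        _ ≤ 2 * (H * Real.cos (Real.pi / (2 * m : ℕ))) * Real.cos (Real.pi / (2 * m : ℕ)) := by
          nlinarith
        _ < 2 * Real.sin (Real.pi / (2 * m : ℕ)) * Real.cos (Real.pi / (2 * m : ℕ)) := by gcongr
        _ ≤ _ := by rw [h2, ← h3]; exact h1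
    · calc _ ≤ H * Real.cos (Real.pi / (2 * m : ℕ)) := by
            rw [hs]; exact mul_le_mul_of_nonneg_left (abs_cos_le_cos_pi_div hn hb) hH
        _ < _ := h.mul_cos_lt hn hH
        _ ≤ _ := by rw [hc]; exact sin_pi_div_le_abs_sin (by omega) hnd
  · rw [abs_sin_eq_abs_cos n (by omega), abs_cos_eq_abs_sin n (by omega)]
    calc _ ≤ _ := mul_le_mul_of_nonneg_left
            (abs_cos_le_cos_pi_div (by omega) (not_dvd_of_odd he (2 * a - d))) hH
      _ < _ := h.2 he
      _ ≤ _ := sin_pi_div_le_abs_sin (by omega) (not_dvd_of_odd he d)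

/-- The fold line at the centre stays within the regular polygon with inscribed circle of radius
one. -/
theorem mul_abs_sin_sub_tan_mul_cos_lt (h : IsNarrow n H) (hn : 2 ≤ n) (hH : 0 ≤ H) {d : ℤ}
    (hd : ¬ (n : ℤ) ∣ d) (a : ℤ) :
    H * |Real.sin (2 * Real.pi * a / n) -
      Real.tan (Real.pi * d / n) * Real.cos (2 * Real.pi * a / n)| < 1 := by
  have hn' : (0 : ℝ) < n := by exact_mod_cast (by omega : 0 < n)
  by_cases hcos : Real.cos (Real.pi * d / n) = 0
  · rw [Real.tan_eq_sin_div_cos, hcos, div_zero, zero_mul, sub_zero]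
    have he : Even n := by
      by_contra he
      exact cos_ne_zero_of_odd hn he d hcos
    rcases hn.eq_or_lt with h2 | h2
    · subst h2
      rw [show 2 * Real.pi * a / (2 : ℕ) = a * Real.pi by push_cast; ring, Real.sin_int_mul_pi]
      simp
    · have h4 : 4 ≤ n := by obtain ⟨m, rfl⟩ := he; omega
      have h5 := h.mul_cos_lt hn hH
      have h6 := sin_le_cos_and h4
      have h7 := cos_pi_div_nonneg hn
      have h8 : H < 1 := by
        by_contra hlt
        push Not at hlt
        nlinarith
      exact (mul_le_of_le_one_right hH (Real.abs_sin_le_one _)).trans_lt h8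
  · have h1 := h.mul_abs_sin_lt hn hH hd hcos a
    have h2 : Real.sin (2 * Real.pi * a / n) -
        Real.tan (Real.pi * d / n) * Real.cos (2 * Real.pi * a / n) =
        Real.sin (Real.pi * ((2 * a - d : ℤ) : ℝ) / n) / Real.cos (Real.pi * d / n) := by
      rw [show Real.pi * ((2 * a - d : ℤ) : ℝ) / n = 2 * Real.pi * a / n - Real.pi * d / n by
        push_cast; ring, Real.sin_sub, Real.tan_eq_sin_div_cos]
      field_simp
    rw [h2, abs_div, mul_div_assoc', div_lt_one (abs_pos.2 hcos)]
    exact h1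

/-- The fold line at the end of a spoke lies within one side of the regular polygon. -/
theorem cos_add_mul_sin_lt (h : IsNarrow n H) (hn : 2 ≤ n) {s : ℝ} (hs : |s| ≤ H) {a : ℤ}
    (ha : ¬ (n : ℤ) ∣ a) :
    Real.cos (2 * Real.pi * a / n) + s * Real.sin (2 * Real.pi * a / n) < 1 := by
  have hH : 0 ≤ H := (abs_nonneg s).trans hs
  have h1 := h.mul_abs_cos_lt hn hH ha
  rw [show 2 * Real.pi * a / n = 2 * (Real.pi * a / n) by ring, Real.sin_two_mul, Real.cos_two_mul]
  set x := Real.pi * a / n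
  have h2 := Real.sin_sq_add_cos_sq x
  -- In terms of the half angle `x`, this is the claim divided by two.
  have h3 : s * (Real.sin x * Real.cos x) < Real.sin x ^ 2 :=
    calc _ ≤ |s * (Real.sin x * Real.cos x)| := le_abs_self _
      _ = |Real.sin x| * (|s| * |Real.cos x|) := by rw [abs_mul, abs_mul]; ring
      _ ≤ |Real.sin x| * (H * |Real.cos x|) := by gcongr
      _ < |Real.sin x| * |Real.sin x| :=
        mul_lt_mul_of_pos_left h1 ((mul_nonneg hH (abs_nonneg _)).trans_lt h1)
      _ = _ := by rw [abs_mul_abs_self, sq]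
  nlinarith

end IsNarrow

theorem abs_squash_lt_one (t : ℝ) : |t / (1 + |t|)| < 1 := by
  rw [abs_div, abs_of_pos (by positivity : 0 < 1 + |t|), div_lt_one (by positivity)]
  linarith

theorem inner_mul_exp (α β x y : ℝ) :
    inner ℝ (Complex.exp (α * Complex.I) * (x + y * Complex.I)) (Complex.exp (β * Complex.I)) =
      x * Real.cos (β - α) + y * Real.sin (β - α) := by
  rw [Complex.inner]
  simp only [Complex.exp_ofReal_mul_I, Complex.mul_re, Complex.conj_re, Complex.conj_im,
    Complex.add_re, Complex.add_im, Complex.mul_im, Complex.I_re, Complex.I_im, Complex.ofReal_re,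
    Complex.ofReal_im, Real.cos_sub, Real.sin_sub]
  ring

theorem inner_exp_mul_exp_mul (α x y u v : ℝ) :
    inner ℝ (Complex.exp (α * Complex.I) * (x + y * Complex.I))
      (Complex.exp (α * Complex.I) * (u + v * Complex.I)) = x * u + y * v := by
  rw [Complex.inner]
  have := Real.sin_sq_add_cos_sq α
  simp only [Complex.exp_ofReal_mul_I, Complex.mul_re, Complex.conj_re, Complex.conj_im,
    Complex.add_re, Complex.add_im, Complex.mul_im, Complex.I_re, Complex.I_im, Complex.ofReal_re,
    Complex.ofReal_im]
  linear_combination (x * u + y * v) * this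

/-! ### Spoke directions and the circumscribed polygon. -/

/-- The direction of the `k`-th of `n` spokes. -/
noncomputable def spokeDir {n : ℕ} (k : Fin n) : ℂ :=
  Complex.exp (((2 * Real.pi * (k : ℕ) / n : ℝ) : ℂ) * Complex.I)

section SpokeDir

variable {n : ℕ}

theorem norm_spokeDir (k : Fin n) : ‖spokeDir k‖ = 1 := Complex.norm_exp_ofReal_mul_I _

theorem inner_spokeDir_mul_spokeDir (k m : Fin n) (x y : ℝ) :
    inner ℝ (spokeDir k * (x + y * Complex.I)) (spokeDir m) =
      x * Real.cos (2 * Real.pi * ((m - k : ℤ) : ℝ) / n) +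
        y * Real.sin (2 * Real.pi * ((m - k : ℤ) : ℝ) / n) := by
  rw [spokeDir, spokeDir, inner_mul_exp]
  have : 2 * Real.pi * (m : ℕ) / n - 2 * Real.pi * (k : ℕ) / n =
      2 * Real.pi * ((m - k : ℤ) : ℝ) / n := by push_cast; ring
  rw [this]

theorem inner_spokeDir_mul_spokeDir_mul (k : Fin n) (x y u v : ℝ) :
    inner ℝ (spokeDir k * (x + y * Complex.I)) (spokeDir k * (u + v * Complex.I)) =
      x * u + y * v := inner_exp_mul_exp_mul _ _ _ _ _

theorem not_dvd_sub_of_ne {k m : Fin n} (h : m ≠ k) : ¬ (n : ℤ) ∣ (m - k : ℤ) := by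
  intro hd
  apply h
  have h1 := k.2
  have h2 := m.2
  have h3 := Int.eq_zero_of_abs_lt_dvd hd (by rw [abs_lt]; constructor <;> omega)
  ext
  omega

theorem two_le_of_ne {k m : Fin n} (h : m ≠ k) : 2 ≤ n := by
  have h1 := k.2
  have h2 := m.2
  have h3 : (m : ℕ) ≠ k := fun h' => h (Fin.ext h')
  omega

theorem inner_spokeDir_lt_one {k m : Fin n} (h : m ≠ k) :
    inner ℝ (spokeDir k) (spokeDir m) < 1 := by
  have hn := two_le_of_ne h
  have h1 := inner_spokeDir_mul_spokeDir k m 1 0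
  simp only [Complex.ofReal_one, Complex.ofReal_zero, zero_mul, add_zero, mul_one, one_mul] at h1
  rw [h1, show 2 * Real.pi * ((m - k : ℤ) : ℝ) / n = 2 * (Real.pi * ((m - k : ℤ) : ℝ) / n) by ring,
    Real.cos_two_mul]
  have h2 := (sin_pi_div_pos hn).trans_le
    (sin_pi_div_le_abs_sin (by omega) (not_dvd_sub_of_ne h))
  have h3 := Real.sin_sq_add_cos_sq (Real.pi * ((m - k : ℤ) : ℝ) / n)
  rw [abs_pos] at h2
  have h4 : 0 < Real.sin (Real.pi * ((m - k : ℤ) : ℝ) / n) ^ 2 := by positivity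
  linarith

theorem inner_spokeDir_self (k : Fin n) : inner ℝ (spokeDir k) (spokeDir k) = (1 : ℝ) := by
  rw [real_inner_self_eq_norm_sq, norm_spokeDir, one_pow]

/-- A function on the plane that vanishes on the sides of the regular polygon whose sides are
perpendicular to the spokes at their ends. -/
noncomputable def sideProd (n : ℕ) (p : ℂ) : ℝ := ∏ m : Fin n, (1 - inner ℝ p (spokeDir m))

theorem continuous_sideProd : Continuous (sideProd n) := by
  unfold sideProd
  fun_prop

theorem sideProd_zero : sideProd n 0 = 1 := by simp [sideProd]

theorem sideProd_eq_zero_iff {p : ℂ} :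
    sideProd n p = 0 ↔ ∃ m : Fin n, inner ℝ p (spokeDir m) = (1 : ℝ) := by
  simp only [sideProd, Finset.prod_eq_zero_iff, Finset.mem_univ, true_and, sub_eq_zero,
    eq_comm (a := (1 : ℝ))]

theorem sideProd_spokeDir (k : Fin n) : sideProd n (spokeDir k) = 0 :=
  sideProd_eq_zero_iff.2 ⟨k, inner_spokeDir_self k⟩

theorem sideProd_mul_spokeDir_ne_zero (k : Fin n) {r : ℝ} (h0 : 0 ≤ r) (h1 : r < 1) :
    sideProd n (r * spokeDir k) ≠ 0 := by
  rw [Ne, sideProd_eq_zero_iff]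
  rintro ⟨m, hm⟩
  rw [← Complex.real_smul, real_inner_smul_left] at hm
  have h2 : inner ℝ (spokeDir k) (spokeDir m) ≤ (1 : ℝ) := by
    rcases eq_or_ne m k with rfl | h
    · exact (inner_spokeDir_self m).le
    · exact (inner_spokeDir_lt_one h).le
  have := mul_le_mul_of_nonneg_left h2 h0
  linarith

end SpokeDir

/-! ### The folded ribbon along the spoked form is allowed. -/

namespace ArcPresentation

variable {n : ℕ} (A : ArcPresentation n)

/-- The height of the initial point of an arc. -/
def level (k : Fin n) : ℝ := (A.arc k 0).2

theorem level_injective : Function.Injective A.level := fun j k h =>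
  A.start_injective (Prod.ext ((A.arc_zero j).trans (A.arc_zero k).symm) h)

theorem next_ne (k : Fin n) : A.next k ≠ k := fun h => by
  have h1 := A.arc_next k
  rw [h] at h1
  exact zero_ne_one (A.arc_injective k h1)

theorem next_symm_ne (k : Fin n) : A.next.symm k ≠ k := fun h =>
  A.next_ne k (by conv_lhs => rw [← h, Equiv.apply_symm_apply])

/-- The tangent of half the turning angle, for the two spokes joined at the initial point of
arc `k`. -/
noncomputable def slope (k : Fin n) : ℝ :=
  -- For opposite spokes this is `tan` at an odd multiple of `π/2`, with default value zero, which
  -- gives a perpendicular segment across the unfolded ribbon.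
  Real.tan (Real.pi * ((A.next.symm k - k : ℤ) : ℝ) / n)

/-- A vector perpendicular to the fold line at the initial point of arc `k`. -/
noncomputable def bisector (k : Fin n) : ℂ := spokeDir k * ((1 : ℝ) + A.slope k * Complex.I)

/-- The signed position of a point relative to the fold line at the initial point of arc `k`. -/
noncomputable def offset (k : Fin n) (p : ℂ) : ℝ := inner ℝ p (A.bisector k)

/-- The ribbon folded along the spoked form, with strands at the heights of the arc-presentation over
the centre and with both strands of each spoke meeting at height zero at its end. -/
noncomputable def spokedLayering (η : ℝ) : Layering (A.spoked 1 one_pos) where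
  fold := Sum.elim (fun k => spokeDir k * (((-A.slope k : ℝ) : ℂ) + (1 : ℝ) * Complex.I))
    (fun k => spokeDir k * ((0 : ℝ) + (1 : ℝ) * Complex.I))
  -- The squashed offset lies in `(-1, 1)` and vanishes exactly on the line of the central fold. The
  -- signs `η` and `-η` separate the outgoing from the incoming strand of the same level.
  height := Sum.elim
    (fun k p => sideProd n p * (A.level k + η * (A.offset k p / (1 + |A.offset k p|))))
    (fun j p => sideProd n p * (A.level (A.next j) +
      -η * (A.offset (A.next j) p / (1 + |A.offset (A.next j) p|))))

variable {A} {η w : ℝ}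

theorem spoked_dir_inl (k : Fin n) : (A.spoked 1 one_pos).dir (Sum.inl k) = spokeDir k := by
  simp [LinkDiagram.dir, spoked, spokeDir, Complex.norm_exp]

theorem spoked_dir_inr (k : Fin n) : (A.spoked 1 one_pos).dir (Sum.inr k) = -spokeDir k := by
  simp [LinkDiagram.dir, spoked, spokeDir, Complex.norm_exp]

theorem spoked_next_symm_inl (k : Fin n) :
    (A.spoked 1 one_pos).next.symm (Sum.inl k) = Sum.inr (A.next.symm k) := rfl

theorem spoked_next_symm_inr (k : Fin n) :
    (A.spoked 1 one_pos).next.symm (Sum.inr k) = Sum.inl k := rfl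

theorem spoked_next_inl (k : Fin n) :
    (A.spoked 1 one_pos).next (Sum.inl k) = Sum.inr k := rfl

theorem spoked_next_inr (k : Fin n) :
    (A.spoked 1 one_pos).next (Sum.inr k) = Sum.inl (A.next k) := rfl

theorem spoked_pos_inl (k : Fin n) : (A.spoked 1 one_pos).pos (Sum.inl k) = 0 := rfl

theorem spoked_pos_inr (k : Fin n) : (A.spoked 1 one_pos).pos (Sum.inr k) = spokeDir k := by
  simp [spoked, spokeDir]

theorem inner_fold_inl (k : Fin n) :
    inner ℝ (spokeDir k * (((-A.slope k : ℝ) : ℂ) + (1 : ℝ) * Complex.I))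
      (spokeDir k + spokeDir (A.next.symm k)) = (0 : ℝ) := by
  rw [inner_add_right, inner_spokeDir_mul_spokeDir, inner_spokeDir_mul_spokeDir]
  simp only [sub_self, Int.cast_zero, mul_zero, zero_div, Real.cos_zero, Real.sin_zero]
  rw [slope]
  set x := Real.pi * ((A.next.symm k - k : ℤ) : ℝ) / n with hx
  rw [show 2 * Real.pi * ((A.next.symm k - k : ℤ) : ℝ) / n = 2 * x by rw [hx]; ring,
    Real.cos_two_mul, Real.sin_two_mul, Real.tan_eq_sin_div_cos]
  by_cases h : Real.cos x = 0
  · simp [h]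
  · field_simp
    ring

theorem mul_abs_slope_lt (h : IsNarrow n (w / 2)) (hw : 0 < w) (k : Fin n) :
    w / 2 * |A.slope k| < 1 := by
  have h1 := h.mul_abs_sin_sub_tan_mul_cos_lt (two_le_of_ne (A.next_symm_ne k)) (by positivity)
    (not_dvd_sub_of_ne (A.next_symm_ne k)) 0
  simpa [slope] using h1

theorem mem_foldLine_inl {k : Fin n} {p : ℂ} :
    p ∈ (A.spokedLayering η).foldLine w (Sum.inl k) ↔
      ∃ s : ℝ, |s| ≤ w / 2 ∧ p = s * (spokeDir k * (((-A.slope k : ℝ) : ℂ) + (1 : ℝ) * Complex.I)) := by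
  simp only [Layering.foldLine, Set.mem_ofPred_eq, spoked_pos_inl, zero_add, spokedLayering,
    Sum.elim_inl]

theorem mem_foldLine_inr {k : Fin n} {p : ℂ} :
    p ∈ (A.spokedLayering η).foldLine w (Sum.inr k) ↔
      ∃ s : ℝ, |s| ≤ w / 2 ∧ p = spokeDir k * ((1 : ℝ) + s * Complex.I) := by
  simp only [Layering.foldLine, Set.mem_ofPred_eq, spoked_pos_inr, spokedLayering, Sum.elim_inr]
  refine exists_congr fun s => and_congr_right fun _ => ?_
  have : spokeDir k + (s : ℂ) * (spokeDir k * (((0 : ℝ) : ℂ) + ((1 : ℝ) : ℂ) * Complex.I)) =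
      spokeDir k * (((1 : ℝ) : ℂ) + s * Complex.I) := by push_cast; ring
  rw [this]

theorem inner_lt_one_of_mem_foldLine_inl (h : IsNarrow n (w / 2)) (hw : 0 < w) {k : Fin n} {p : ℂ}
    (hp : p ∈ (A.spokedLayering η).foldLine w (Sum.inl k)) (m : Fin n) :
    inner ℝ p (spokeDir m) < (1 : ℝ) := by
  obtain ⟨s, hs, rfl⟩ := mem_foldLine_inl.1 hp
  have h1 := h.mul_abs_sin_sub_tan_mul_cos_lt (two_le_of_ne (A.next_symm_ne k)) (by positivity)
    (not_dvd_sub_of_ne (A.next_symm_ne k)) (m - k)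
  rw [← Complex.real_smul, real_inner_smul_left, inner_spokeDir_mul_spokeDir]
  refine (le_abs_self _).trans_lt ?_
  rw [abs_mul]
  refine (mul_le_mul_of_nonneg_right hs (abs_nonneg _)).trans_lt ?_
  rw [neg_mul, one_mul, add_comm, ← sub_eq_add_neg]
  exact h1

theorem offset_of_mem_foldLine_inl {k : Fin n} {p : ℂ}
    (hp : p ∈ (A.spokedLayering η).foldLine w (Sum.inl k)) : A.offset k p = 0 := by
  obtain ⟨s, hs, rfl⟩ := mem_foldLine_inl.1 hp
  rw [offset, bisector, ← Complex.real_smul, real_inner_smul_left, inner_spokeDir_mul_spokeDir_mul]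
  ring

theorem inner_of_mem_foldLine_inr {k : Fin n} {p : ℂ}
    (hp : p ∈ (A.spokedLayering η).foldLine w (Sum.inr k)) : inner ℝ p (spokeDir k) = (1 : ℝ) := by
  obtain ⟨s, hs, rfl⟩ := mem_foldLine_inr.1 hp
  rw [inner_spokeDir_mul_spokeDir]
  simp

theorem inner_lt_one_of_mem_foldLine_inr (h : IsNarrow n (w / 2)) {k m : Fin n} (hm : m ≠ k)
    {p : ℂ} (hp : p ∈ (A.spokedLayering η).foldLine w (Sum.inr k)) :
    inner ℝ p (spokeDir m) < (1 : ℝ) := by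
  obtain ⟨s, hs, rfl⟩ := mem_foldLine_inr.1 hp
  rw [inner_spokeDir_mul_spokeDir, one_mul]
  exact h.cos_add_mul_sin_lt (two_le_of_ne hm) hs (not_dvd_sub_of_ne hm)

/-- On the tip fold the offset is `1 + s * slope` with `|s| ≤ w / 2`, so the bound for the slope
decides. This separates the two folds of a piece and shows that the outgoing piece lies on one side
of its central fold. -/
theorem offset_pos_of_mem_foldLine_inr (h : IsNarrow n (w / 2)) (hw : 0 < w) {k : Fin n} {p : ℂ}
    (hp : p ∈ (A.spokedLayering η).foldLine w (Sum.inr k)) : 0 < A.offset k p := by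
  obtain ⟨s, hs, rfl⟩ := mem_foldLine_inr.1 hp
  rw [offset, bisector, inner_spokeDir_mul_spokeDir_mul]
  have h1 := mul_abs_slope_lt (A := A) h hw k
  have h2 : |s * A.slope k| < 1 := by
    rw [abs_mul]
    exact (mul_le_mul_of_nonneg_right hs (abs_nonneg _)).trans_lt h1
  have := (abs_lt.1 h2).1
  linarith

/-- The arc from whose initial point a strand of the spoked form has its level. -/
def levelArc (A : ArcPresentation n) : Fin n ⊕ Fin n → Fin n := Sum.elim id A.next

/-- The spoke of a strand of the spoked form. -/
def spokeOf (_ : ArcPresentation n) : Fin n ⊕ Fin n → Fin n := Sum.elim id id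

theorem convex_foldLine (R : Layering (A.spoked 1 one_pos)) (x : Fin n ⊕ Fin n) :
    Convex ℝ (R.foldLine w x) := by
  rintro _ ⟨s, hs, rfl⟩ _ ⟨t, ht, rfl⟩ a b ha hb hab
  refine ⟨a * s + b * t, ?_, ?_⟩
  · rw [abs_le] at *
    constructor <;> nlinarith
  · rw [show b = 1 - a by linarith]
    simp only [Complex.real_smul]
    push_cast
    ring

theorem nonempty_foldLine (R : Layering (A.spoked 1 one_pos)) (hw : 0 < w) (x : Fin n ⊕ Fin n) :
    (R.foldLine w x).Nonempty :=
  ⟨_, 0, by rw [abs_zero]; positivity, rfl⟩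

/-- Outgoing and incoming pieces are treated alike: `q` is always on the central fold and `r` on the
tip fold, with weights `a` and `b`. -/
theorem exists_of_mem_piece (hw : 0 < w) {x : Fin n ⊕ Fin n} {p : ℂ}
    (hp : p ∈ (A.spokedLayering η).piece w x) :
    ∃ k, (x = Sum.inl k ∨ x = Sum.inr (A.next.symm k)) ∧
      ∃ q ∈ (A.spokedLayering η).foldLine w (Sum.inl k),
      ∃ r ∈ (A.spokedLayering η).foldLine w (Sum.inr (A.spokeOf x)), ∃ a b : ℝ, 0 ≤ a ∧ 0 ≤ b ∧
        a + b = 1 ∧ a • q + b • r = p := by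
  rw [Layering.piece, Convex.convexHull_union (convex_foldLine _ _) (convex_foldLine _ _)
    (nonempty_foldLine _ hw _) (nonempty_foldLine _ hw _), mem_convexJoin] at hp
  obtain ⟨q, hq, r, hr, a, b, ha, hb, hab, rfl⟩ := hp
  rcases x with k | k
  · exact ⟨k, Or.inl rfl, q, hq, r, hr, a, b, ha, hb, hab, rfl⟩
  · exact ⟨A.next k, Or.inr (by simp), r, hr, q, hq, b, a, hb, ha, by rw [add_comm, hab],
      add_comm _ _⟩

/-- Pieces of the ribbon meet the sides of the polygon in fold lines only. -/
theorem mem_foldLine_inr_of_mem_piece (h : IsNarrow n (w / 2)) (hw : 0 < w) {x : Fin n ⊕ Fin n}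
    {p : ℂ} (hp : p ∈ (A.spokedLayering η).piece w x) (h0 : sideProd n p = 0) :
    p ∈ (A.spokedLayering η).foldLine w (Sum.inr (A.spokeOf x)) := by
  obtain ⟨k, -, q, hq, r, hr, a, b, ha, hb, hab, rfl⟩ := exists_of_mem_piece hw hp
  obtain ⟨m, hm⟩ := sideProd_eq_zero_iff.1 h0
  have h1 := inner_lt_one_of_mem_foldLine_inl h hw hq m
  have h2 : inner ℝ r (spokeDir m) ≤ (1 : ℝ) := by
    rcases eq_or_ne m (A.spokeOf x) with rfl | h'
    · exact (inner_of_mem_foldLine_inr hr).le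
    · exact (inner_lt_one_of_mem_foldLine_inr h h' hr).le
  rw [inner_add_left, real_inner_smul_left, real_inner_smul_left] at hm
  -- The functional `⟨·, e_m⟩` is below one at `q` and at most one at `r`, so the value one leaves
  -- no weight on `q`.
  have ha0 : a = 0 := by
    by_contra hne
    have := mul_lt_mul_of_pos_left h1 (ha.lt_of_ne' hne)
    have := mul_le_mul_of_nonneg_left h2 hb
    linarith
  have hb1 : b = 1 := by linarith
  simpa [ha0, hb1] using hr

theorem mem_foldLine_inl_of_mem_piece (h : IsNarrow n (w / 2)) (hw : 0 < w) {k : Fin n}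
    {p : ℂ} (hp : p ∈ (A.spokedLayering η).piece w (Sum.inl k)) (h0 : A.offset k p = 0) :
    p ∈ (A.spokedLayering η).foldLine w (Sum.inl k) := by
  obtain ⟨k', hk, q, hq, r, hr, a, b, ha, hb, hab, rfl⟩ := exists_of_mem_piece hw hp
  obtain rfl : k = k' := by simpa using hk
  have h1 := offset_of_mem_foldLine_inl hq
  have h2 := offset_pos_of_mem_foldLine_inr h hw hr
  simp only [offset, inner_add_left, real_inner_smul_left] at h0 h1 h2
  rw [h1, mul_zero, zero_add] at h0
  have hb0 : b = 0 := (mul_eq_zero.1 h0).resolve_right h2.ne'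
  have ha1 : a = 1 := by linarith
  simpa [hb0, ha1] using hq

theorem continuous_offset (k : Fin n) : Continuous (A.offset k) := by
  unfold offset
  fun_prop

theorem continuous_height (x : Fin n ⊕ Fin n) : Continuous ((A.spokedLayering η).height x) := by
  have h1 := continuous_sideProd (n := n)
  have h2 : ∀ (k : Fin n) (c : ℝ), Continuous fun p =>
      sideProd n p * (A.level k + c * (A.offset k p / (1 + |A.offset k p|))) := fun k c => by
    have h3 := continuous_offset (A := A) k
    have h4 : ∀ p, 1 + |A.offset k p| ≠ 0 := fun p => by positivity
    fun_prop (disch := exact h4 _)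
  rcases x with k | k
  · exact h2 k η
  · exact h2 (A.next k) (-η)

/-- Off the sides of the polygon, strands of different levels are at different heights. -/
theorem levelArc_eq_of_height_eq (hη : ∀ j k, j ≠ k → 2 * η ≤ |A.level j - A.level k|) (h0 : 0 < η)
    {x y : Fin n ⊕ Fin n} {p : ℂ} (hp : sideProd n p ≠ 0)
    (h : (A.spokedLayering η).height x p = (A.spokedLayering η).height y p) :
    A.levelArc x = A.levelArc y := by
  have key : ∀ (j k : Fin n) (c d : ℝ), |c| = η → |d| = η →
      sideProd n p * (A.level j + c * (A.offset j p / (1 + |A.offset j p|))) =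
      sideProd n p * (A.level k + d * (A.offset k p / (1 + |A.offset k p|))) → j = k := by
    intro j k c d hc hd h
    by_contra hne
    have h1 := mul_left_cancel₀ hp h
    have h2 : |c * (A.offset j p / (1 + |A.offset j p|))| < η := by
      rw [abs_mul, hc]; exact mul_lt_of_lt_one_right h0 (abs_squash_lt_one _)
    have h3 : |d * (A.offset k p / (1 + |A.offset k p|))| < η := by
      rw [abs_mul, hd]; exact mul_lt_of_lt_one_right h0 (abs_squash_lt_one _)
    have h4 := hη j k hne
    rw [show A.level j - A.level k = d * (A.offset k p / (1 + |A.offset k p|)) -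
      c * (A.offset j p / (1 + |A.offset j p|)) by linarith] at h4
    have h5 := abs_sub (d * (A.offset k p / (1 + |A.offset k p|)))
      (c * (A.offset j p / (1 + |A.offset j p|)))
    linarith
  have e1 : |η| = η := abs_of_pos h0
  have e2 : |-η| = η := by rw [abs_neg, e1]
  rcases x with j | j <;> rcases y with k | k
  · exact key _ _ _ _ e1 e1 h
  · exact key _ _ _ _ e1 e2 h
  · exact key _ _ _ _ e2 e1 h
  · exact key _ _ _ _ e2 e2 h

theorem offset_eq_zero_of_height_eq (h0 : 0 < η) {j : Fin n} {p : ℂ} (hp : sideProd n p ≠ 0)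
    (h : (A.spokedLayering η).height (Sum.inl (A.next j)) p =
      (A.spokedLayering η).height (Sum.inr j) p) : A.offset (A.next j) p = 0 := by
  simp only [spokedLayering, Sum.elim_inl, Sum.elim_inr] at h
  have h1 := mul_left_cancel₀ hp h
  have h2 : η * (A.offset (A.next j) p / (1 + |A.offset (A.next j) p|)) = 0 := by linarith
  have h3 := (mul_eq_zero.1 h2).resolve_left h0.ne'
  exact (div_eq_zero_iff.1 h3).resolve_right (by positivity)

theorem spokedLayering_isAllowed (h : IsNarrow n (w / 2)) (hw : 0 < w)
    (hη : ∀ j k, j ≠ k → 2 * η ≤ |A.level j - A.level k|) (h0 : 0 < η) :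
    (A.spokedLayering η).IsAllowed w where
  width_pos := hw
  fold_perp := by
    rintro (k | k)
    · rw [spoked_next_symm_inl, spoked_dir_inl, spoked_dir_inr, sub_neg_eq_add]
      exact inner_fold_inl k
    · rw [spoked_next_symm_inr, spoked_dir_inl, spoked_dir_inr, inner_sub_right, inner_neg_right]
      simp only [spokedLayering, Sum.elim_inr]
      rw [inner_spokeDir_mul_spokeDir]
      simp
  fold_width := by
    have hI : ∀ k : Fin n, Complex.I * spokeDir k =
        spokeDir k * ((0 : ℝ) + (1 : ℝ) * Complex.I) := fun k => by push_cast; ring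
    rintro (k | k)
    · rw [spoked_dir_inl, hI]
      simp only [spokedLayering, Sum.elim_inl]
      rw [inner_spokeDir_mul_spokeDir_mul]
      simp
    · rw [spoked_dir_inr, mul_neg, hI, inner_neg_right]
      simp only [spokedLayering, Sum.elim_inr]
      rw [inner_spokeDir_mul_spokeDir_mul]
      simp
  fold_disjoint := by
    rintro (k | k)
    · rw [spoked_next_inl, Set.disjoint_left]
      intro p hp hp'
      exact (offset_pos_of_mem_foldLine_inr h hw hp').ne' (offset_of_mem_foldLine_inl hp)
    · rw [spoked_next_inr, Set.disjoint_left]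
      intro p hp hp'
      exact (inner_lt_one_of_mem_foldLine_inl h hw hp' k).ne (inner_of_mem_foldLine_inr hp)
  height_continuous := fun x => (continuous_height x).continuousOn
  height_join := by
    rintro (k | k) p hp
    · rw [spoked_next_inl] at hp ⊢
      have : sideProd n p = 0 := sideProd_eq_zero_iff.2 ⟨k, inner_of_mem_foldLine_inr hp⟩
      simp [spokedLayering, this]
    · rw [spoked_next_inr] at hp ⊢
      have := offset_of_mem_foldLine_inl hp
      simp [spokedLayering, this]
  height_ne := by
    intro x y hxy p hp heq
    -- On the sides both pieces are in their tip folds, which forces a common spoke. Off the sides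
    -- equal heights force a common level, and then the opposite tilts force a point of the central
    -- fold.
    by_cases hg : sideProd n p = 0
    · have h1 := mem_foldLine_inr_of_mem_piece h hw hp.1 hg
      have h2 := mem_foldLine_inr_of_mem_piece h hw hp.2 hg
      have hs : A.spokeOf x = A.spokeOf y := by
        by_contra hne
        exact (inner_lt_one_of_mem_foldLine_inr h hne h2).ne (inner_of_mem_foldLine_inr h1)
      rcases x with j | j <;> rcases y with k | k
      · exact absurd (congrArg Sum.inl hs) hxy
      · exact Or.inl ⟨congrArg Sum.inr hs.symm, h2⟩
      · exact Or.inr ⟨congrArg Sum.inr hs, h1⟩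
      · exact absurd (congrArg Sum.inr hs) hxy
    · have hl := levelArc_eq_of_height_eq hη h0 hg heq
      rcases x with j | j <;> rcases y with k | k
      · exact absurd (congrArg Sum.inl hl) hxy
      · obtain rfl : j = A.next k := hl
        exact Or.inr ⟨rfl, mem_foldLine_inl_of_mem_piece h hw hp.1
          (offset_eq_zero_of_height_eq h0 hg heq)⟩
      · obtain rfl : A.next j = k := hl
        exact Or.inl ⟨rfl, mem_foldLine_inl_of_mem_piece h hw hp.2
          (offset_eq_zero_of_height_eq h0 hg heq.symm)⟩
      · exact absurd (congrArg Sum.inr (A.next.injective hl)) hxy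

end ArcPresentation

/-! ### The centre line of the lifted ribbon as an arc-presentation. -/

namespace ArcPresentation

variable {n : ℕ} {A : ArcPresentation n} {η w : ℝ}

theorem height_spokeDir (x : Fin n ⊕ Fin n) (k : Fin n) :
    (A.spokedLayering η).height x (spokeDir k) = 0 := by
  rcases x with j | j <;> simp [spokedLayering, sideProd_spokeDir]

theorem height_inl_zero (k : Fin n) : (A.spokedLayering η).height (Sum.inl k) 0 = A.level k := by
  simp [spokedLayering, sideProd_zero, offset]

theorem height_inr_zero (k : Fin n) :
    (A.spokedLayering η).height (Sum.inr k) 0 = A.level (A.next k) := by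
  simp [spokedLayering, sideProd_zero, offset]

/-- The arc in a page of the lifted spoked form. -/
noncomputable def spokedArc (A : ArcPresentation n) (η : ℝ) (k : Fin n) (t : unitInterval) : ℝ × ℝ :=
  (1 - |2 * (t : ℝ) - 1|, if (t : ℝ) ≤ 1 / 2
    then (A.spokedLayering η).height (Sum.inl k) (((1 - |2 * (t : ℝ) - 1| : ℝ) : ℂ) * spokeDir k)
    else (A.spokedLayering η).height (Sum.inr k) (((1 - |2 * (t : ℝ) - 1| : ℝ) : ℂ) * spokeDir k))

theorem continuous_spokedArc (k : Fin n) : Continuous (A.spokedArc η k) := by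
  refine Continuous.prodMk (by fun_prop) (Continuous.if_le ?_ ?_ (by fun_prop) (by fun_prop) ?_)
  · exact (continuous_height _).comp (by fun_prop)
  · exact (continuous_height _).comp (by fun_prop)
  · intro t ht
    rw [ht]
    norm_num
    rw [height_spokeDir, height_spokeDir]

theorem spokedArc_zero (k : Fin n) : A.spokedArc η k 0 = (0, A.level k) := by
  simp [spokedArc, height_inl_zero]

theorem spokedArc_one (k : Fin n) : A.spokedArc η k 1 = (0, A.level (A.next k)) := by
  norm_num [spokedArc, height_inr_zero]

theorem injective_spokedArc (hη : ∀ j k, j ≠ k → 2 * η ≤ |A.level j - A.level k|) (h0 : 0 < η)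
    (k : Fin n) : Function.Injective (A.spokedArc η k) := by
  have key : ∀ s t : unitInterval, (s : ℝ) ≤ 1 / 2 → 1 / 2 < (t : ℝ) →
      A.spokedArc η k s ≠ A.spokedArc η k t := by
    intro s t hs ht h
    simp only [spokedArc, Prod.mk.injEq, if_pos hs, if_neg ht.not_ge] at h
    obtain ⟨h1, h2⟩ := h
    rw [h1] at h2
    have h3 : |2 * (t : ℝ) - 1| = 2 * t - 1 := abs_of_pos (by linarith)
    have h4 := sideProd_mul_spokeDir_ne_zero k (r := 1 - |2 * (t : ℝ) - 1|)
      (by rw [h3]; linarith [t.2.2]) (by rw [h3]; linarith)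
    -- At equal radius below one the two strands of a spoke have different levels, those of arc `k`
    -- and of its successor, so their heights differ.
    exact A.next_ne k (levelArc_eq_of_height_eq hη h0 h4 h2).symm
  intro s t h
  have h1 := congrArg Prod.fst h
  simp only [spokedArc, sub_right_inj] at h1
  rcases le_or_gt (s : ℝ) (1 / 2) with hs | hs <;> rcases le_or_gt (t : ℝ) (1 / 2) with ht | ht
  · rw [abs_of_nonpos (by linarith), abs_of_nonpos (by linarith)] at h1
    exact Subtype.ext (by linarith)
  · exact absurd h (key s t hs ht)
  · exact absurd h.symm (key t s ht hs)
  · rw [abs_of_nonneg (by linarith), abs_of_nonneg (by linarith)] at h1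
    exact Subtype.ext (by linarith)

/-- The lifted spoked form as an arc-presentation. -/
noncomputable def spokedPresentation (A : ArcPresentation n)
    (hη : ∀ j k, j ≠ k → 2 * η ≤ |A.level j - A.level k|) (h0 : 0 < η) : ArcPresentation n where
  angle k := 2 * Real.pi * (k : ℕ) / n
  angle_nonneg k := by positivity
  angle_lt k := by
    have h1 : (0 : ℝ) < n := by exact_mod_cast k.pos
    have h2 : ((k : ℕ) : ℝ) < n := by exact_mod_cast k.2
    rw [div_lt_iff₀ h1]
    have := Real.pi_pos
    gcongr
  angle_strictMono j k h := by
    have h1 : (0 : ℝ) < n := by exact_mod_cast k.pos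
    have h2 : ((j : ℕ) : ℝ) < (k : ℕ) := by exact_mod_cast h
    have := Real.pi_pos
    simp only
    gcongr
  arc := A.spokedArc η
  arc_continuous := continuous_spokedArc
  arc_injective := injective_spokedArc hη h0
  arc_zero k := by rw [spokedArc_zero]
  arc_one k := by rw [spokedArc_one]
  arc_pos k t h1 h2 := by
    have h1' : (0 : ℝ) < t := h1
    have h2' : (t : ℝ) < 1 := h2
    simp only [spokedArc, sub_pos, abs_lt]
    constructor <;> linarith
  next := A.next
  arc_next k := by rw [spokedArc_zero, spokedArc_one]
  start_injective j k h := by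
    simp only [spokedArc_zero] at h
    have h' : A.level j = A.level k := (Prod.mk.inj h).2
    exact A.level_injective h'

theorem mem_segment_zero_iff {p q : ℂ} :
    p ∈ segment ℝ 0 q ↔ ∃ r : ℝ, 0 ≤ r ∧ r ≤ 1 ∧ p = r * q := by
  rw [segment_eq_image]
  constructor
  · rintro ⟨r, hr, rfl⟩
    exact ⟨r, hr.1, hr.2, by simp⟩
  · rintro ⟨r, h0, h1, rfl⟩
    exact ⟨r, ⟨h0, h1⟩, by simp⟩

theorem carrier_spokedPresentation (hη : ∀ j k, j ≠ k → 2 * η ≤ |A.level j - A.level k|)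
    (h0 : 0 < η) : (A.spokedPresentation hη h0).carrier = (A.spokedLayering η).core := by
  ext y
  simp only [carrier_eq_sweep, sweep, Set.mem_range, Prod.exists, Layering.core, Set.mem_iUnion,
    Set.mem_image, spokedPresentation]
  constructor
  · rintro ⟨k, t, rfl⟩
    have ht0 := t.2.1
    have ht1 := t.2.2
    have hseg : ((1 - |2 * (t : ℝ) - 1| : ℝ) : ℂ) * spokeDir k ∈ segment ℝ 0 (spokeDir k) :=
      mem_segment_zero_iff.2 ⟨_, by rw [sub_nonneg, abs_le]; constructor <;> linarith,
        by linarith [abs_nonneg (2 * (t : ℝ) - 1)], rfl⟩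
    by_cases h : (t : ℝ) ≤ 1 / 2
    · refine ⟨Sum.inl k, ((1 - |2 * (t : ℝ) - 1| : ℝ) : ℂ) * spokeDir k, ?_, ?_⟩
      · rwa [spoked_next_inl, spoked_pos_inl, spoked_pos_inr]
      · simp only [spokedArc, if_pos h]; rfl
    · refine ⟨Sum.inr k, ((1 - |2 * (t : ℝ) - 1| : ℝ) : ℂ) * spokeDir k, ?_, ?_⟩
      · rwa [spoked_next_inr, spoked_pos_inl, spoked_pos_inr, segment_symm]
      · simp only [spokedArc, if_neg h]; rfl
  · rintro ⟨k | k, p, hp, rfl⟩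
    · rw [spoked_next_inl, spoked_pos_inl, spoked_pos_inr] at hp
      obtain ⟨r, hr0, hr1, rfl⟩ := mem_segment_zero_iff.1 hp
      refine ⟨k, ⟨r / 2, by linarith, by linarith⟩, ?_⟩
      have h1 : 1 - |2 * (r / 2) - 1| = r := by
        rw [abs_of_nonpos (by linarith)]; ring
      have h2 : r / 2 ≤ 1 / 2 := by linarith
      simp only [spokedArc, if_pos h2, h1]; rfl
    · rw [spoked_next_inr, spoked_pos_inl, spoked_pos_inr, segment_symm] at hp
      obtain ⟨r, hr0, hr1, rfl⟩ := mem_segment_zero_iff.1 hp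
      refine ⟨k, ⟨1 - r / 2, by linarith, by linarith⟩, ?_⟩
      have h1 : 1 - |2 * (1 - r / 2) - 1| = r := by
        rw [abs_of_nonneg (by linarith)]; ring
      -- The tip has parameter `1/2`, which belongs to the outgoing branch; both branches have
      -- height zero there.
      rcases hr1.eq_or_lt with rfl | hr
      · norm_num [spokedArc, height_spokeDir]
        simp [spokeDir]
      · have h2 : ¬ 1 - r / 2 ≤ 1 / 2 := by linarith
        simp only [spokedArc, if_neg h2, h1]; rfl

/-! ### Ribbonlength and the bound. -/

theorem spoked_ribbonlength (A : ArcPresentation n) (w : ℝ) :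
    (A.spoked 1 one_pos).ribbonlength w = 2 * n / w := by
  have h : (A.spoked 1 one_pos).length = 2 * n := by
    rw [LinkDiagram.length, Fintype.sum_sum_type]
    simp only [spoked_next_inl, spoked_next_inr, spoked_pos_inl, spoked_pos_inr, sub_zero, zero_sub,
      norm_neg, norm_spokeDir, Finset.sum_const, Finset.card_univ, Fintype.card_fin, nsmul_eq_mul]
    ring
  rw [LinkDiagram.ribbonlength, h]

theorem isNarrow_of_spokedBound_lt (hn : 2 ≤ n) (hw : 0 < w) (h : spokedBound n < 2 * n / w) :
    IsNarrow n (w / 2) := by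
  have hn' : (0 : ℝ) < n := by exact_mod_cast (by omega : 0 < n)
  have key : ∀ m : ℕ, 2 ≤ m → n * Real.cot (Real.pi / m) < 2 * n / w →
      w / 2 * Real.cos (Real.pi / m) < Real.sin (Real.pi / m) := by
    intro m hm h
    have hs := sin_pi_div_pos hm
    rw [Real.cot_eq_cos_div_sin, lt_div_iff₀ hw] at h
    have h1 : n * (Real.cos (Real.pi / m) / Real.sin (Real.pi / m)) * w =
        2 * n * (w / 2 * Real.cos (Real.pi / m) / Real.sin (Real.pi / m)) := by ring
    rw [h1] at h
    have h2 := (mul_lt_iff_lt_one_right (by positivity)).1 h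
    rwa [div_lt_one hs] at h2
  rw [spokedBound] at h
  constructor
  · intro he
    rw [if_pos he] at h
    exact key n hn h
  · intro he
    rw [if_neg he] at h
    exact key (2 * n) (by omega) (by push_cast; exact h)

theorem spokedBound_nonneg (hn : 2 ≤ n) : 0 ≤ spokedBound n := by
  have key : ∀ m : ℕ, 2 ≤ m → 0 ≤ n * Real.cot (Real.pi / m) := fun m hm => by
    rw [Real.cot_eq_cos_div_sin]
    have := sin_pi_div_pos hm
    have := cos_pi_div_nonneg hm
    positivity
  rw [spokedBound]
  split_ifs
  · exact key n hn
  · exact_mod_cast key (2 * n) (by omega)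

theorem isAllowed_of_spokedBound_lt (hη : ∀ j k, j ≠ k → 2 * η ≤ |A.level j - A.level k|)
    (h0 : 0 < η) (hw : 0 < w) (h : spokedBound n < (A.spoked 1 one_pos).ribbonlength w) :
    (A.spokedLayering η).IsAllowed w := by
  rw [spoked_ribbonlength] at h
  rcases Nat.eq_zero_or_pos n with rfl | hn
  · simp [spokedBound] at h
  -- A single page is impossible, since its arc would have to be its own successor.
  · have k : Fin n := ⟨0, hn⟩
    exact spokedLayering_isAllowed (isNarrow_of_spokedBound_lt (two_le_of_ne (A.next_ne k)) hw h)
      hw hη h0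

end ArcPresentation

/-- Every arc-presentation `A` with `α` pages of a link `L` is realized by a folded ribbon link in
spoked form: the diagram is the spoked form of `A`, the strands over the centre are stacked in the
order of the points of `A` on the axis, and the link type is that of `L`.  The ribbon is allowed for
every width `w` for which the ribbonlength exceeds the bound; hence allowed ribbons
have ribbonlength at most the bound up to an arbitrarily small error. -/
theorem mainTheorem4 (α : ℕ) (A : ArcPresentation α) (L : Set Space) (hL : IsLink L)
    (hA : A.Presents L) :
    ∃ (ℓ : ℝ) (hℓ : 0 < ℓ) (R : Layering (A.spoked ℓ hℓ)),
      AmbientIsotopic R.core L ∧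
      (∀ j k : Fin α, R.height (Sum.inl j) 0 < R.height (Sum.inl k) 0 ↔
        (A.arc j 0).2 < (A.arc k 0).2) ∧
      (∀ w : ℝ, 0 < w →
        ArcPresentation.spokedBound α < (A.spoked ℓ hℓ).ribbonlength w → R.IsAllowed w) ∧
      (∀ ε : ℝ, 0 < ε → ∃ w : ℝ, R.IsAllowed w ∧
        (A.spoked ℓ hℓ).ribbonlength w ≤ ArcPresentation.spokedBound α + ε) := by
  have hgap : ∀ j k, j ≠ k → 0 < |A.level j - A.level k| / 2 := fun j k h => by
    have := abs_pos.2 (sub_ne_zero.2 (A.level_injective.ne h))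
    positivity
  obtain ⟨η, h0, hη'⟩ := exists_pos_forall_ne_le (fun j k => |A.level j - A.level k| / 2) hgap
  have hη : ∀ j k, j ≠ k → 2 * η ≤ |A.level j - A.level k| := fun j k h => by
    have := hη' j k h
    linarith
  have hallowed : ∀ w : ℝ, 0 < w →
      ArcPresentation.spokedBound α < (A.spoked 1 one_pos).ribbonlength w →
      (A.spokedLayering η).IsAllowed w := fun w hw h =>
    ArcPresentation.isAllowed_of_spokedBound_lt hη h0 hw h
  refine ⟨1, one_pos, A.spokedLayering η, ?_, fun j k => ?_, hallowed, fun ε hε => ?_⟩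
  · rw [← ArcPresentation.carrier_spokedPresentation hη h0]
    refine AmbientIsotopic.trans (AmbientIsotopic.symm ?_) hA
    refine ArcPresentation.ambientIsotopic_carrier rfl fun k => ?_
    exact (congrArg Prod.snd (ArcPresentation.spokedArc_zero (A := A) (η := η) k)).symm
  · rw [ArcPresentation.height_inl_zero, ArcPresentation.height_inl_zero]
    rfl
  -- Without pages the bound and the ribbonlength are both zero, so the strict inequality fails, but
  -- every positive width is allowed vacuously. Otherwise the width is chosen to make the
  -- ribbonlength exactly the bound plus `ε`.
  · rcases Nat.eq_zero_or_pos α with rfl | hα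
    · have : IsEmpty (Fin 0 ⊕ Fin 0) := inferInstance
      refine ⟨1, ?_, ?_⟩
      · constructor <;> first | exact one_pos | exact fun x => this.elim x
      · simp [ArcPresentation.spoked_ribbonlength, ArcPresentation.spokedBound, hε.le]
    · have hb := ArcPresentation.spokedBound_nonneg (two_le_of_ne (A.next_ne ⟨0, hα⟩))
      have hα' : (0 : ℝ) < α := by exact_mod_cast hα
      have hlen : (A.spoked 1 one_pos).ribbonlength
          (2 * α / (ArcPresentation.spokedBound α + ε)) = ArcPresentation.spokedBound α + ε := by
        rw [ArcPresentation.spoked_ribbonlength]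
        have : ArcPresentation.spokedBound α + ε ≠ 0 := by positivity
        field_simp
      exact ⟨2 * α / (ArcPresentation.spokedBound α + ε), hallowed _ (by positivity)
        (by rw [hlen]; linarith), hlen.le⟩
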